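/- **Conventions.** Let $P$ be an at most countable set of labels, ordered as a first label, a second label, and so on. A *partitionable space with labels $P$ and structures of kind $\mathbf C$* is a topological space $S$ partitioned into subsets $S_p$ ($p\in P$, the fixed neighborhoods), each a neighborhood of all its points and each endowed with the structure of an object of $\mathbf C$; a homomorphism $S\to T$ is a family of $\mathbf C$-morphisms $S_p\to T_p$, $p\in P$. This gives the category $\mathbf{Part}(P,\mathbf C)$. A *structural space* $(X,\mathcal F)$ is a topological space $X$ with a presheaf $\mathcal F$ on $X$ with values in $\mathbf{Part}(P,\mathbf C)$ satisfying locality and gluing for the points of its values, for covers with a nonempty index set. It decomposes into the presheaves $\mathcal F_p(U):=\mathcal F(U)_p$ with values in $\mathbf C$; $\widetilde{\mathcal F}_p$ denotes the sheafification. A *square/rectangle* consists of cochain complexes $C_0^\bullet,C_1^\bullet,\dots$ (the rows; $0$ below the last row if there are finitely many) and vertical homomorphisms $C_n^q\to C_{n+1}^q$; the trivial family of vertical homomorphisms is the zero family. Its *square/rectangular cohomology* is the cohomology of the complexes obtained by following the arrows (to the right or downwards) along the admissible paths, i.e. the paths on which consecutive arrows compose to $0$. It is a *double complex* if all columns are complexes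 and all small squares commute; then there are also the groups $H^{n,q}$ of the double complex (horizontal, vertical, and iterated in both orders) and the cohomology of the total complex. For a commutative ring $\mathbb K$ (e.g. a field, or $\mathbb Z$) and a $\mathbb K$-linear category $\mathcal A$, let $C^n(\mathcal A)=\prod_{A_0,\dots,A_n}\mathrm{Hom}_{\mathbb K}(\mathcal A(A_{n-1},A_n)\otimes\cdots\otimes\mathcal A(A_0,A_1),\mathcal A(A_0,A_n))$ with the Hochschild coboundary. For a space $X$ with a sheaf $\mathcal O$ of (not necessarily commutative) $\mathbb K$-algebras, $C^\bullet(X,\mathcal O):=C^\bullet(\mathrm{Inj}\,\mathbf{Mod}(X))$, where $\mathbf{Mod}(X)$ is the category of sheaves of right $\mathcal O$-modules. **Theorem (Structured Hochschild cohomology).** (1) Let $(X,\mathcal F)$ be a structural ringed space, $\mathcal F:X\to\mathbf{Part}(P,\mathbf{Alg}_{\mathbb K})$ (for $\mathbb K=\mathbb Z$ the structures are arbitrary rings). The complexes $C^\bullet(X,\widetilde{\mathcal F}_p)$, in the order of the labels, form the rows of a square/rectangle; with the trivial vertical homomorphisms every path is admissible and the square/rectangle is a double complex. Let $\widetilde X=\bigsqcup_p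 X\times\{p\}$ be the disjoint union, a semi-structural ringed space (a space that is a union of ringed spaces) with pieces $(X\times\{p\},\widetilde{\mathcal F}_p)$. The relabelling $x\mapsto(x,p)$ induces, through direct image of right modules, isomorphisms of complexes $C^\bullet(X,\widetilde{\mathcal F}_p)\cong C^\bullet(X\times\{p\},\widetilde{\mathcal F}_p)$ for all $p$, and these give a bijection between the families of vertical homomorphisms for $(X,\mathcal F)$ and those for $\widetilde X$ (with the same order of the labels), compatible with the isomorphisms and preserving the trivial family. For corresponding families, the admissible paths are the same and the square/rectangular cohomologies are isomorphic; one square/rectangle is a double complex if and only if the other is, and then the cohomologies of the double complexes and of the total complexes are isomorphic. (2) Let $\mathbb K$ be a noetherian ring. A *structural locally ringed space* is a structural space $(X,\mathcal F)$ with commutative rings as structures such that all stalks of all $\mathcal F_p$ are local rings; it is a *structural affine scheme* if every $(X,\widetilde{\mathcal F}_p)$ is isomorphic to the spectrum of a ring, and a *structural scheme* if it is covered by open subsets $V$ such that $(V,\mathcal F|_V)$ is a structural affine scheme. Let $(X,\mathcal F)$ be a structural scheme over $\mathbb K$, i.e. with morphisms of locally ringed spaces $(X,\widetilde{\mathcal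 F}_p)\to\mathrm{Spec}\,\mathbb K$ for all $p$, which is separated and of finite type, i.e. each $(X,\widetilde{\mathcal F}_p)$ that is a scheme is separated and of finite type over $\mathbb K$. Then every $X_p:=(X,\widetilde{\mathcal F}_p)$ is a scheme, hence separated and of finite type over $\mathbb K$, and for every open $V\subseteq X$ such that $(V,\mathcal F|_V)$ is a structural locally ringed space, the $p$-th locally ringed space of $(V,\mathcal F|_V)$ is isomorphic to the open subspace $V$ of $X_p$. Injective resolutions exist in the category of $\mathcal O_{X_p\times_{\mathbb K}X_p}$-modules, and for all $\mathcal O_{X_p}$-modules $\mathcal A_p$ the complexes representing $R\mathrm{Hom}_{\mathcal O_{X_p\times_{\mathbb K} X_p}}(\Delta_*\mathcal O_{X_p},\Delta_*\mathcal A_p)$, computed with any injective resolutions of $\Delta_*\mathcal A_p$, have as cohomology the right derived functors of $\mathrm{Hom}(\Delta_*\mathcal O_{X_p},-)$ and form the rows of a square/rectangle, for which, with the trivial vertical homomorphisms, every path is admissible and which is then a double complex; so the square/rectangular, double complex and total cohomologies are defined. -/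

import Mathlib

open CategoryTheory CategoryTheory.Limits Opposite TopologicalSpace

universe w v u

namespace Structured

noncomputable section

/-! ### Hochschild complex of a linear category -/

section Hochschild

variable {𝒜 : Type u} [Category.{v} 𝒜]

/-- The composite `A a ⟶ A b` of the arrows `f a, f (a+1), …, f (b-1)` of a chain of arrows
`A 0 ⟶ A 1 ⟶ ⋯ ⟶ A n`. -/
def chainComp {n : ℕ} {A : Fin (n + 1) → 𝒜} (f : ∀ i : Fin n, A i.castSucc ⟶ A i.succ)
    {a b : Fin (n + 1)} (h : a ≤ b) : A a ⟶ A b :=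
  (ComposableArrows.mkOfObjOfMapSucc A f).map (homOfLE h)

section chainComp

variable {n : ℕ} {A : Fin (n + 1) → 𝒜} (f : ∀ i : Fin n, A i.castSucc ⟶ A i.succ)

lemma chainComp_self (a : Fin (n + 1)) (h : a ≤ a) : chainComp f h = 𝟙 (A a) :=
  (ComposableArrows.mkOfObjOfMapSucc A f).map_id a

lemma chainComp_comp {a b c : Fin (n + 1)} (h : a ≤ b) (h' : b ≤ c) :
    chainComp f h ≫ chainComp f h' = chainComp f (h.trans h') :=
  ((ComposableArrows.mkOfObjOfMapSucc A f).map_comp (homOfLE h) (homOfLE h')).symm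

lemma chainComp_succ (i : Fin n) (h : i.castSucc ≤ i.succ) : chainComp f h = f i :=
  ComposableArrows.mkOfObjOfMapSucc_map_succ A f i.1 i.2

lemma chainComp_congr {f g : ∀ i : Fin n, A i.castSucc ⟶ A i.succ} {a b : Fin (n + 1)}
    (h : a ≤ b) (hfg : ∀ i : Fin n, a ≤ i.castSucc → i.succ ≤ b → f i = g i) :
    chainComp f h = chainComp g h := by
  induction b using Fin.induction with
  | zero =>
    obtain rfl : a = 0 := le_antisymm h (Fin.zero_le _)
    rw [chainComp_self, chainComp_self]
  | succ b ih =>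
    rcases h.eq_or_lt with rfl | hlt
    · rw [chainComp_self, chainComp_self]
    · have hab : a ≤ b.castSucc := Fin.le_castSucc_iff.2 hlt
      have hb : b.castSucc ≤ b.succ := Fin.castSucc_lt_succ.le
      rw [← chainComp_comp f hab hb, ← chainComp_comp g hab hb, chainComp_succ, chainComp_succ,
        ih hab (fun i hi hi' => hfg i hi (hi'.trans hb)), hfg b hab le_rfl]

/-- Composing a chain in two steps. -/
lemma chainComp_chainComp {m : ℕ} (θ : Fin (m + 1) →o Fin (n + 1)) {a b : Fin (m + 1)}
    (h : a ≤ b) :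
    chainComp (A := A ∘ θ)
      (fun i : Fin m => chainComp f (θ.monotone (Fin.castSucc_lt_succ (i := i)).le)) h =
      chainComp f (θ.monotone h) := by
  induction b using Fin.induction with
  | zero =>
    obtain rfl : a = 0 := le_antisymm h (Fin.zero_le _)
    rw [chainComp_self, chainComp_self]; rfl
  | succ b ih =>
    rcases h.eq_or_lt with rfl | hlt
    · rw [chainComp_self, chainComp_self]; rfl
    · have hab : a ≤ b.castSucc := Fin.le_castSucc_iff.2 hlt
      have hb : b.castSucc ≤ b.succ := Fin.castSucc_lt_succ.le
      rw [← chainComp_comp _ hab hb, chainComp_succ, ih hab]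
      exact chainComp_comp f _ _

open scoped Classical in
lemma chainComp_update_of_not_mem (k : Fin n) (x : A k.castSucc ⟶ A k.succ)
    {a b : Fin (n + 1)} (h : a ≤ b) (hk : ¬ (a ≤ k.castSucc ∧ k.succ ≤ b)) :
    chainComp (Function.update f k x) h = chainComp f h := by
  refine chainComp_congr h fun i hi hi' => ?_
  rw [Function.update_of_ne]
  rintro rfl
  exact hk ⟨hi, hi'⟩

open scoped Classical in
lemma chainComp_update_of_mem (k : Fin n) (x : A k.castSucc ⟶ A k.succ)
    {a b : Fin (n + 1)} (h : a ≤ b) (ha : a ≤ k.castSucc) (hb : k.succ ≤ b) :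
    chainComp (Function.update f k x) h = chainComp f ha ≫ x ≫ chainComp f hb := by
  have hk : k.castSucc ≤ k.succ := Fin.castSucc_lt_succ.le
  rw [← chainComp_comp _ ha (hk.trans hb), ← chainComp_comp _ hk hb, chainComp_succ,
    Function.update_self, chainComp_update_of_not_mem f k x ha,
    chainComp_update_of_not_mem f k x hb]
  · rintro ⟨h1, -⟩; exact absurd h1 (not_le.2 Fin.castSucc_lt_succ)
  · rintro ⟨-, h1⟩; exact absurd h1 (not_le.2 Fin.castSucc_lt_succ)

end chainComp

variable (K : Type w) [CommRing K] [Preadditive 𝒜] [Linear K 𝒜]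

variable (𝒜) in
/-- The Hochschild `n`-cochains of the `K`-linear category `𝒜`:
`∏_{A₀, …, Aₙ} Hom_K (𝒜(Aₙ₋₁, Aₙ) ⊗ ⋯ ⊗ 𝒜(A₀, A₁), 𝒜(A₀, Aₙ))`, where linear maps out of the
tensor product are written as multilinear maps. -/
abbrev HochschildCochain (n : ℕ) : Type _ :=
  ∀ A : Fin (n + 1) → 𝒜,
    MultilinearMap K (fun i : Fin n => (A i.castSucc ⟶ A i.succ)) (A 0 ⟶ A (Fin.last n))

variable {K}

/-- The operation on cochains attached to a monotone map `θ`: compose the arrows of the chain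
inside the intervals cut out by `θ`, apply the cochain, and multiply on both sides by the
arrows outside. For the `i`-th coface map this is the `i`-th summand of the
Hochschild coboundary. -/
def hochschildMapFun {m n : ℕ} (θ : Fin (m + 1) →o Fin (n + 1)) (c : HochschildCochain 𝒜 K m)
    (A : Fin (n + 1) → 𝒜) (f : ∀ i : Fin n, A i.castSucc ⟶ A i.succ) : A 0 ⟶ A (Fin.last n) :=
  chainComp f (Fin.zero_le (θ 0)) ≫
    c (A ∘ θ) (fun i => chainComp f (θ.monotone (Fin.castSucc_lt_succ (i := i)).le)) ≫
      chainComp f (Fin.le_last (θ (Fin.last m)))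

open scoped Classical in
/-- `hochschildMapFun` in one variable. -/
lemma hochschildMapFun_update_exists {m n : ℕ} (θ : Fin (m + 1) →o Fin (n + 1))
    (c : HochschildCochain 𝒜 K m) (A : Fin (n + 1) → 𝒜)
    (f : ∀ i : Fin n, A i.castSucc ⟶ A i.succ) (k : Fin n) :
    ∃ L : (A k.castSucc ⟶ A k.succ) →ₗ[K] (A 0 ⟶ A (Fin.last n)),
      ∀ x, hochschildMapFun θ c A (Function.update f k x) = L x := by
  have hk : k.castSucc < k.succ := Fin.castSucc_lt_succ
  by_cases h0 : k.succ ≤ θ 0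
  · refine ⟨(Linear.rightComp K _ (chainComp f h0 ≫
        c (A ∘ θ) (fun i => chainComp f (θ.monotone (Fin.castSucc_lt_succ (i := i)).le)) ≫
          chainComp f (Fin.le_last (θ (Fin.last m))))) ∘ₗ
        (Linear.leftComp K _ (chainComp f (Fin.zero_le k.castSucc))), fun x => ?_⟩
    unfold hochschildMapFun
    rw [chainComp_update_of_mem f k x _ (Fin.zero_le _) h0,
      chainComp_update_of_not_mem f k x (Fin.le_last _)]
    · have : ∀ i : Fin m, chainComp (Function.update f k x)
          (θ.monotone (Fin.castSucc_lt_succ (i := i)).le) =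
          chainComp f (θ.monotone (Fin.castSucc_lt_succ (i := i)).le) := fun i =>
        chainComp_update_of_not_mem f k x _ fun h =>
          absurd (h0.trans ((θ.monotone (Fin.zero_le _)).trans h.1)) (not_le.2 hk)
      simp only [this]
      simp
    · rintro ⟨h, -⟩
      exact absurd (h0.trans ((θ.monotone (Fin.zero_le _)).trans h)) (not_le.2 hk)
  by_cases h1 : θ (Fin.last m) ≤ k.castSucc
  · refine ⟨(Linear.leftComp K _ (chainComp f (Fin.zero_le (θ 0)) ≫
        c (A ∘ θ) (fun i => chainComp f (θ.monotone (Fin.castSucc_lt_succ (i := i)).le)) ≫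
          chainComp f h1)) ∘ₗ
        (Linear.rightComp K _ (chainComp f (Fin.le_last k.succ))), fun x => ?_⟩
    unfold hochschildMapFun
    rw [chainComp_update_of_mem f k x _ h1 (Fin.le_last _),
      chainComp_update_of_not_mem f k x (Fin.zero_le _) (fun h => h0 h.2)]
    have : ∀ i : Fin m, chainComp (Function.update f k x)
          (θ.monotone (Fin.castSucc_lt_succ (i := i)).le) =
          chainComp f (θ.monotone (Fin.castSucc_lt_succ (i := i)).le) := fun i =>
        chainComp_update_of_not_mem f k x _ fun h =>
          absurd (h.2.trans ((θ.monotone (Fin.le_last _)).trans h1)) (not_le.2 hk)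
    simp only [this]
    simp
  · -- `k` lies in exactly one interval `[θ j, θ (j + 1))`
    have hex : ∃ j : Fin m, θ j.castSucc ≤ k.castSucc ∧ k.succ ≤ θ j.succ := by
      by_contra hne
      push Not at hne
      have : ∀ j : Fin (m + 1), θ j ≤ k.castSucc := by
        intro j
        induction j using Fin.induction with
        | zero => exact Fin.le_castSucc_iff.2 (not_le.1 h0)
        | succ j ih => exact Fin.le_castSucc_iff.2 (hne j ih)
      exact h1 (this _)
    obtain ⟨j, hj, hj'⟩ := hex
    refine ⟨(Linear.leftComp K _ (chainComp f (Fin.zero_le (θ 0)))) ∘ₗ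
      (Linear.rightComp K _ (chainComp f (Fin.le_last (θ (Fin.last m))))) ∘ₗ
      ((c (A ∘ θ)).toLinearMap
        (fun i => chainComp f (θ.monotone (Fin.castSucc_lt_succ (i := i)).le)) j) ∘ₗ
      (Linear.leftComp K _ (chainComp f hj)) ∘ₗ (Linear.rightComp K _ (chainComp f hj')),
      fun x => ?_⟩
    unfold hochschildMapFun
    rw [chainComp_update_of_not_mem f k x (Fin.zero_le _) (fun h => h0 h.2),
      chainComp_update_of_not_mem f k x (Fin.le_last _) (fun h => h1 h.1)]
    have : (fun i : Fin m => chainComp (Function.update f k x)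
          (θ.monotone (Fin.castSucc_lt_succ (i := i)).le)) =
        Function.update (fun i : Fin m => chainComp f
          (θ.monotone (Fin.castSucc_lt_succ (i := i)).le)) j
          (chainComp f hj ≫ x ≫ chainComp f hj') := by
      funext i
      by_cases hij : i = j
      · subst hij
        rw [Function.update_self, chainComp_update_of_mem f k x _ hj hj']
      · rw [Function.update_of_ne hij]
        refine chainComp_update_of_not_mem f k x _ fun h => ?_
        rcases lt_or_gt_of_ne hij with hlt | hlt
        · have : θ i.succ ≤ θ j.castSucc := θ.monotone (by
            rw [Fin.le_iff_val_le_val]; simpa using hlt)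
          exact absurd (h.2.trans (this.trans hj)) (not_le.2 hk)
        · have : θ j.succ ≤ θ i.castSucc := θ.monotone (by
            rw [Fin.le_iff_val_le_val]; simpa using hlt)
          exact absurd (hj'.trans (this.trans h.1)) (not_le.2 hk)
    rw [this]
    simp

/-- `hochschildMapFun` as a map of cochains. -/
def hochschildMap {m n : ℕ} (θ : Fin (m + 1) →o Fin (n + 1)) :
    HochschildCochain 𝒜 K m →ₗ[K] HochschildCochain 𝒜 K n where
  toFun c A :=
    { toFun := hochschildMapFun θ c A
      map_update_add' := fun f k x y => by
        classical
        obtain ⟨L, hL⟩ := hochschildMapFun_update_exists θ c A f k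
        convert L.map_add x y using 1
        · rw [← hL]; congr!
        · rw [← hL, ← hL]; congr!
      map_update_smul' := fun f k r x => by
        classical
        obtain ⟨L, hL⟩ := hochschildMapFun_update_exists θ c A f k
        convert L.map_smul r x using 1
        · rw [← hL]; congr!
        · rw [← hL]; congr! }
  map_add' c d := by
    ext A f
    simp [hochschildMapFun]
  map_smul' r c := by
    ext A f
    simp [hochschildMapFun]

lemma hochschildMapFun_id {n : ℕ} (c : HochschildCochain 𝒜 K n) (A : Fin (n + 1) → 𝒜)
    (f : ∀ i : Fin n, A i.castSucc ⟶ A i.succ) :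
    hochschildMapFun OrderHom.id c A f = c A f := by
  unfold hochschildMapFun
  have h1 : chainComp f (Fin.zero_le (OrderHom.id (0 : Fin (n + 1)))) = 𝟙 (A 0) :=
    chainComp_self f 0 le_rfl
  have h2 : chainComp f (Fin.le_last (OrderHom.id (Fin.last n))) = 𝟙 (A (Fin.last n)) :=
    chainComp_self f _ le_rfl
  have h3 : (fun i : Fin n => chainComp f
      (OrderHom.id.monotone (Fin.castSucc_lt_succ (i := i)).le)) = f :=
    funext fun i => chainComp_succ f i _
  rw [h1, h2, h3]
  exact (Category.id_comp _).trans (Category.comp_id _)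

lemma hochschildMapFun_comp {l m n : ℕ} (θ : Fin (l + 1) →o Fin (m + 1))
    (η : Fin (m + 1) →o Fin (n + 1)) (c : HochschildCochain 𝒜 K l) (A : Fin (n + 1) → 𝒜)
    (f : ∀ i : Fin n, A i.castSucc ⟶ A i.succ) :
    hochschildMapFun (η.comp θ) c A f = hochschildMapFun η (hochschildMap θ c) A f := by
  have key : hochschildMapFun η (hochschildMap θ c) A f =
      chainComp f (Fin.zero_le (η 0)) ≫
        hochschildMapFun θ c (A ∘ η) (fun i => chainComp f
          (η.monotone (Fin.castSucc_lt_succ (i := i)).le)) ≫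
        chainComp f (Fin.le_last (η (Fin.last m))) := rfl
  rw [key]
  unfold hochschildMapFun
  have h1 : (fun i : Fin l => chainComp (A := A ∘ η) (fun i => chainComp f
      (η.monotone (Fin.castSucc_lt_succ (i := i)).le))
      (θ.monotone (Fin.castSucc_lt_succ (i := i)).le)) =
      fun i : Fin l => chainComp f
        ((η.comp θ).monotone (Fin.castSucc_lt_succ (i := i)).le) :=
    funext fun i => chainComp_chainComp f η _
  rw [h1, chainComp_chainComp f η, chainComp_chainComp f η]
  have h2 : chainComp f (Fin.zero_le ((η.comp θ) 0)) =
      chainComp f (Fin.zero_le (η 0)) ≫ chainComp f (η.monotone (Fin.zero_le (θ 0))) :=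
    (chainComp_comp f _ _).symm
  have h3 : chainComp f (Fin.le_last ((η.comp θ) (Fin.last l))) =
      chainComp f (η.monotone (Fin.le_last (θ (Fin.last l)))) ≫
        chainComp f (Fin.le_last (η (Fin.last m))) :=
    (chainComp_comp f _ _).symm
  rw [h2, h3]
  simp only [Category.assoc]
  exact Category.assoc _ _ _

variable (𝒜 K) in
/-- The cosimplicial `K`-module of Hochschild cochains. -/
def hochschildCosimplicial : CosimplicialObject (ModuleCat.{max u v} K) where
  obj n := ModuleCat.of K (HochschildCochain 𝒜 K n.len)
  map θ := ModuleCat.ofHom (hochschildMap θ.toOrderHom)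
  map_id n := by
    ext c A f
    exact hochschildMapFun_id c A f
  map_comp θ η := by
    ext c A f
    exact hochschildMapFun_comp θ.toOrderHom η.toOrderHom c A f

variable (𝒜 K) in
/-- The Hochschild complex of the `K`-linear category `𝒜`, with coboundary
`(dc)(f₁, …, fₙ₊₁) = f₁ ≫ c(f₂, …) + ∑ (-1)ⁱ c(…, fᵢ ≫ fᵢ₊₁, …) + (-1)ⁿ⁺¹ c(f₁, …, fₙ) ≫ fₙ₊₁`. -/
def hochschildComplex : CochainComplex (ModuleCat.{max u v} K) ℕ :=
  (AlgebraicTopology.alternatingCofaceMapComplex _).obj (hochschildCosimplicial 𝒜 K)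

end Hochschild

/-! ### Ringed spaces over `K` and right modules -/

section RingedSpace

variable (K : Type u) [CommRing K]

/-- A `K`-linear ringed space: a topological space with a sheaf of (not necessarily commutative)
`K`-algebras. For `K = ℤ` this is a sheaf of rings. -/
structure LinearRingedSpace where
  space : TopCat.{u}
  sheaf : TopCat.Sheaf (AlgCat.{u} K) space

variable {K}

/-- The functor sending a `K`-algebra `A` to the opposite ring of `A`; left modules over the
opposite ring are right `A`-modules. -/
def oppositeRing : AlgCat.{u} K ⥤ RingCat.{u} where
  obj A := RingCat.of (A : Type u)ᵐᵒᵖ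
  map f := RingCat.ofHom (RingHom.op f.hom.toRingHom)

/-- The underlying sets of `A` and its opposite. -/
def oppositeRingForgetIso : oppositeRing (K := K) ⋙ forget RingCat.{u} ≅ forget (AlgCat.{u} K) :=
  NatIso.ofComponents (fun A => (MulOpposite.opEquiv (α := A)).symm.toIso) (fun _ => rfl)

/-- The sheaf of opposite rings. -/
def oppositeSheaf {X : TopCat.{u}} (O : TopCat.Sheaf (AlgCat.{u} K) X) :
    Sheaf (Opens.grothendieckTopology X) RingCat.{u} :=
  ⟨O.obj ⋙ oppositeRing, by
    have h := (Presheaf.isSheaf_iff_isSheaf_forget (Opens.grothendieckTopology X) O.obj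
      (forget (AlgCat.{u} K))).1 O.property
    exact (Presheaf.isSheaf_iff_isSheaf_forget (Opens.grothendieckTopology X) _
      (forget RingCat.{u})).2 ((Presheaf.isSheaf_of_iso_iff
        (Functor.isoWhiskerLeft O.obj oppositeRingForgetIso)).2 h)⟩

/-- The category of sheaves of right modules over the ringed space `(X, O)`. -/
abbrev RightModules {X : TopCat.{u}} (O : TopCat.Sheaf (AlgCat.{u} K) X) : Type (u + 1) :=
  SheafOfModules.{u} (oppositeSheaf O)

variable {X : TopCat.{u}} {O : TopCat.Sheaf (AlgCat.{u} K) X}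

variable (O) in
/-- The image of a scalar in the sections of `O`. -/
def scalar (U : (Opens X)ᵒᵖ) (k : K) : (oppositeSheaf O).obj.obj U :=
  (MulOpposite.op (algebraMap K (O.obj.obj U) k) : (O.obj.obj U : Type u)ᵐᵒᵖ)

lemma restrict_scalar {U V : (Opens X)ᵒᵖ} (i : U ⟶ V) (k : K) :
    (oppositeSheaf O).obj.map i (scalar O U k) = scalar O V k :=
  congrArg MulOpposite.op ((O.obj.map i).hom.commutes k)

lemma scalar_mul_comm (U : (Opens X)ᵒᵖ) (k : K) (r : (oppositeSheaf O).obj.obj U) :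
    scalar O U k * r = r * scalar O U k :=
  MulOpposite.unop_injective (Algebra.commutes k (MulOpposite.unop
    (show (O.obj.obj U : Type u)ᵐᵒᵖ from r))).symm

lemma scalar_one (U : (Opens X)ᵒᵖ) : scalar O U 1 = 1 :=
  congrArg MulOpposite.op (map_one _)

lemma scalar_zero (U : (Opens X)ᵒᵖ) : scalar O U 0 = 0 :=
  congrArg MulOpposite.op (map_zero _)

lemma scalar_add (U : (Opens X)ᵒᵖ) (a b : K) : scalar O U (a + b) = scalar O U a + scalar O U b :=
  congrArg MulOpposite.op (map_add _ _ _)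

lemma scalar_mul (U : (Opens X)ᵒᵖ) (a b : K) : scalar O U (a * b) = scalar O U a * scalar O U b :=
  congrArg MulOpposite.op ((congrArg _ (mul_comm a b)).trans (map_mul _ _ _))

/-- Scalars act on morphisms of sheaves of right modules section by section. -/
def RightModules.smulHom (k : K) {M N : RightModules O} (φ : M ⟶ N) : M ⟶ N where
  val :=
    { app := fun U => ModuleCat.ofHom
        { toFun := fun m => scalar O U k • φ.val.app U m
          map_add' := fun x y => by rw [map_add, smul_add]
          map_smul' := fun r x => by
            rw [map_smul, RingHom.id_apply, ← mul_smul, ← mul_smul, scalar_mul_comm] }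
      naturality := fun {U V} i => by
        ext m
        refine Eq.trans ?_ (N.val.map_smul i (scalar O U k) (φ.val.app U m)).symm
        rw [restrict_scalar, ← PresheafOfModules.naturality_apply]
        rfl }

lemma RightModules.hom_ext' {M N : RightModules O} {φ ψ : M ⟶ N}
    (h : ∀ (U : (Opens X)ᵒᵖ) (m : M.val.obj U), φ.val.app U m = ψ.val.app U m) : φ = ψ := by
  ext U m
  exact h U m

instance : Linear K (RightModules O) where
  homModule M N :=
    { smul := fun k φ => RightModules.smulHom k φ
      one_smul := fun φ => RightModules.hom_ext' fun U m => by
        change scalar O U 1 • φ.val.app U m = _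
        rw [scalar_one, one_smul]
      mul_smul := fun a b φ => RightModules.hom_ext' fun U m => by
        change scalar O U (a * b) • φ.val.app U m = scalar O U a • scalar O U b • φ.val.app U m
        rw [scalar_mul, mul_smul]
      smul_zero := fun a => RightModules.hom_ext' fun U _ => by
        change scalar O U a • (0 : N.val.obj U) = 0
        rw [smul_zero]
      smul_add := fun a φ ψ => RightModules.hom_ext' fun U m =>
        smul_add (scalar O U a) (φ.val.app U m) (ψ.val.app U m)
      add_smul := fun a b φ => RightModules.hom_ext' fun U m => by
        change scalar O U (a + b) • φ.val.app U m =
          scalar O U a • φ.val.app U m + scalar O U b • φ.val.app U m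
        rw [scalar_add, add_smul]
      zero_smul := fun φ => RightModules.hom_ext' fun U m => by
        change scalar O U 0 • φ.val.app U m = 0
        rw [scalar_zero, zero_smul] }
  smul_comp _ _ _ k φ ψ := RightModules.hom_ext' fun U m =>
    (ψ.val.app U).hom.map_smul (scalar O U k) (φ.val.app U m)
  comp_smul _ _ _ _ _ _ := rfl

namespace LinearRingedSpace

/-- The Hochschild complex `C(X, O)` of a ringed space: the Hochschild complex of the
`K`-linear category of injective sheaves of right `O`-modules. -/
def hochschild (Y : LinearRingedSpace K) : CochainComplex (ModuleCat.{u + 1} K) ℕ :=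
  hochschildComplex (InjectiveObject (RightModules Y.sheaf)) K

/-- The ringed space on `Z` obtained by transporting the sheaf along a continuous map
`Y ⟶ Z` (direct image). -/
def map (Y : LinearRingedSpace K) {Z : TopCat.{u}} (j : Y.space ⟶ Z) : LinearRingedSpace K where
  space := Z
  sheaf := (TopCat.Sheaf.pushforward _ j).obj Y.sheaf

/-- Direct image of right modules along `Y.space ⟶ Z`. -/
def pushforwardModules (Y : LinearRingedSpace K) {Z : TopCat.{u}} (j : Y.space ⟶ Z) :
    RightModules Y.sheaf ⥤ RightModules (Y.map j).sheaf :=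
  SheafOfModules.pushforward (F := Opens.map j) (S := oppositeSheaf (Y.map j).sheaf) (𝟙 _)

end LinearRingedSpace

end RingedSpace

/-! ### Squares and rectangles -/

section Rectangle

/-- The signs of the total complex of a double complex indexed by `ℕ × ℕ`. -/
instance : ComplexShape.TensorSigns (ComplexShape.up ℕ) where
  ε' := MonoidHom.mk' (fun i : Multiplicative ℕ => (-1 : ℤˣ) ^ (Multiplicative.toAdd i))
    (fun a b => pow_add (-1 : ℤˣ) a.toAdd b.toAdd)
  rel_add p q r (hpq : p + 1 = q) := by
    change p + r + 1 = q + r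
    lia
  add_rel p q r (hpq : p + 1 = q) := by
    change r + p + 1 = r + q
    lia
  ε'_succ := by
    rintro p _ rfl
    change (-1 : ℤˣ) ^ (p + 1) = -(-1 : ℤˣ) ^ p
    rw [pow_succ, mul_neg, mul_one]

/-- An ordering of the labels as a first one, a second one, and so on. There are at most countably
many labels; if there are `N` of them, they are numbered `0, …, N - 1`. -/
structure RowOrder (P : Type) where
  num : P → ℕ
  injective : Function.Injective num
  exists_of_lt : ∀ (p : P) (n : ℕ), n < num p → ∃ q, num q = n

variable {V : Type u} [Category.{v} V] [Abelian V]

open scoped Classical in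
/-- The rows `0, 1, 2, …` of the square or rectangle: the `n`-th one is the complex attached
to the `n`-th label; below the last row of a rectangle there is `0`. -/
def RowOrder.row {P : Type} (ord : RowOrder P) (C : P → CochainComplex V ℕ) (n : ℕ) :
    CochainComplex V ℕ :=
  if h : ∃ p, ord.num p = n then C h.choose else HomologicalComplex.zero

lemma RowOrder.row_of_exists {P : Type} (ord : RowOrder P) (C : P → CochainComplex V ℕ) {n : ℕ}
    (h : ∃ p, ord.num p = n) : ord.row C n = C h.choose :=
  dif_pos h

lemma RowOrder.row_of_not_exists {P : Type} (ord : RowOrder P) (C : P → CochainComplex V ℕ) {n : ℕ}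
    (h : ¬ ∃ p, ord.num p = n) : ord.row C n = HomologicalComplex.zero :=
  dif_neg h

open scoped Classical in
/-- Isomorphisms of the complexes give isomorphisms of the rows. -/
def RowOrder.rowIso {P : Type} (ord : RowOrder P) {C D : P → CochainComplex V ℕ}
    (e : ∀ p, C p ≅ D p) (n : ℕ) : ord.row C n ≅ ord.row D n :=
  if h : ∃ p, ord.num p = n then
    eqToIso (ord.row_of_exists C h) ≪≫ e h.choose ≪≫ eqToIso (ord.row_of_exists D h).symm
  else eqToIso ((ord.row_of_not_exists C h).trans (ord.row_of_not_exists D h).symm)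

/-- A family of vertical homomorphisms between consecutive rows. -/
abbrev VerticalFamily (row : ℕ → CochainComplex V ℕ) : Type v :=
  ∀ n q : ℕ, (row n).X q ⟶ (row (n + 1)).X q

variable (V) in
/-- A square/rectangle: rows which are cochain complexes, and vertical homomorphisms. -/
structure Rectangle where
  row : ℕ → CochainComplex V ℕ
  vert : VerticalFamily row

/-- The square/rectangle with the trivial vertical homomorphisms. -/
def Rectangle.trivial (row : ℕ → CochainComplex V ℕ) : Rectangle V := ⟨row, fun _ _ => 0⟩

/-- The two directions of the arrows of a square/rectangle. -/
inductive Direction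
  | right
  | down

/-- The end of the arrow starting at `x = (row, column)`. -/
def Direction.next : Direction → ℕ × ℕ → ℕ × ℕ
  | right, x => (x.1, x.2 + 1)
  | down, x => (x.1 + 1, x.2)

/-- A path in the square/rectangle, following horizontal and vertical arrows. -/
structure LatticePath where
  start : ℕ × ℕ
  step : ℕ → Direction

/-- The vertices of a path. -/
def LatticePath.pos (γ : LatticePath) : ℕ → ℕ × ℕ
  | 0 => γ.start
  | i + 1 => (γ.step i).next (γ.pos i)

namespace Rectangle

variable (R : Rectangle V)

/-- The entry in a given position. -/
abbrev entry (x : ℕ × ℕ) : V := (R.row x.1).X x.2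

/-- The arrow leaving a given position in a given direction. -/
def arrow : ∀ (d : Direction) (x : ℕ × ℕ), R.entry x ⟶ R.entry (d.next x)
  | .right, x => (R.row x.1).d x.2 (x.2 + 1)
  | .down, x => R.vert x.1 x.2

/-- A path along which consecutive arrows compose to zero. -/
def IsAdmissible (γ : LatticePath) : Prop :=
  ∀ i : ℕ, R.arrow (γ.step i) (γ.pos i) ≫ R.arrow (γ.step (i + 1)) (γ.pos (i + 1)) = 0

/-- The cochain complex along an admissible path. -/
def pathComplex (γ : LatticePath) (h : R.IsAdmissible γ) : CochainComplex V ℕ :=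
  CochainComplex.of (fun i => R.entry (γ.pos i)) (fun i => R.arrow (γ.step i) (γ.pos i)) h

/-- Square/rectangular cohomology: the cohomology along an admissible path. Its groups are the
quotients `ker / im` of consecutive arrows, horizontal or vertical. -/
def squareCohomology (γ : LatticePath) (h : R.IsAdmissible γ) (i : ℕ) : V :=
  (R.pathComplex γ h).homology i

/-- The square/rectangle is a double complex: the columns are complexes and all the
small squares commute. -/
structure IsDoubleComplex : Prop where
  vert_vert : ∀ n q, R.vert n q ≫ R.vert (n + 1) q = 0
  comm : ∀ n q, (R.row n).d q (q + 1) ≫ R.vert n (q + 1) =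
    R.vert n q ≫ (R.row (n + 1)).d q (q + 1)

variable {R}

/-- The double complex; the first index is the row. -/
def IsDoubleComplex.doubleComplex (h : R.IsDoubleComplex) :
    HomologicalComplex₂ V (ComplexShape.up ℕ) (ComplexShape.up ℕ) :=
  CochainComplex.of R.row
    (fun n =>
      { f := fun q => R.vert n q
        comm' := by
          rintro q _ rfl
          exact (h.comm n q).symm })
    (fun n => by
      ext q
      exact h.vert_vert n q)

/-- The cohomology groups `H^{n,q}` of the double complex for the horizontal differential. -/
def IsDoubleComplex.horizontalCohomology (h : R.IsDoubleComplex) (n q : ℕ) : V :=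
  (h.doubleComplex.X n).homology q

/-- The cohomology groups `H^{n,q}` of the double complex for the vertical differential. -/
def IsDoubleComplex.verticalCohomology (h : R.IsDoubleComplex) (n q : ℕ) : V :=
  (h.doubleComplex.flip.X q).homology n

/-- The iterated cohomology groups `H^{n,q}` of the double complex: the horizontal cohomology
of the vertical cohomology. -/
def IsDoubleComplex.iteratedCohomology (h : R.IsDoubleComplex) (n q : ℕ) : V :=
  (HomologicalComplex.homology h.doubleComplex n).homology q

/-- The iterated cohomology groups `H^{n,q}` of the double complex: the vertical cohomology
of the horizontal cohomology. -/
def IsDoubleComplex.iteratedCohomology' (h : R.IsDoubleComplex) (n q : ℕ) : V :=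
  (HomologicalComplex.homology h.doubleComplex.flip q).homology n

/-- The cohomology of the total complex of the double complex. -/
def IsDoubleComplex.totalCohomology [HasCoproducts.{0} V] (h : R.IsDoubleComplex) (k : ℕ) : V :=
  (h.doubleComplex.total (ComplexShape.up ℕ)).homology k

/-- Two squares/rectangles have the same cohomologies: they have the same admissible paths
and isomorphic square/rectangular cohomologies, one is a double complex if and only if the
other is, and then the cohomologies of the double complexes and of the total complexes
are isomorphic. -/
structure SameCohomology [HasCoproducts.{0} V] (R S : Rectangle V) : Prop where
  isAdmissible_iff : ∀ γ, R.IsAdmissible γ ↔ S.IsAdmissible γ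
  square : ∀ γ (hR : R.IsAdmissible γ) (hS : S.IsAdmissible γ) (i : ℕ),
    Nonempty (R.squareCohomology γ hR i ≅ S.squareCohomology γ hS i)
  isDoubleComplex_iff : R.IsDoubleComplex ↔ S.IsDoubleComplex
  horizontal : ∀ (hR : R.IsDoubleComplex) (hS : S.IsDoubleComplex) (n q : ℕ),
    Nonempty (hR.horizontalCohomology n q ≅ hS.horizontalCohomology n q)
  vertical : ∀ (hR : R.IsDoubleComplex) (hS : S.IsDoubleComplex) (n q : ℕ),
    Nonempty (hR.verticalCohomology n q ≅ hS.verticalCohomology n q)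
  iterated : ∀ (hR : R.IsDoubleComplex) (hS : S.IsDoubleComplex) (n q : ℕ),
    Nonempty (hR.iteratedCohomology n q ≅ hS.iteratedCohomology n q)
  iterated' : ∀ (hR : R.IsDoubleComplex) (hS : S.IsDoubleComplex) (n q : ℕ),
    Nonempty (hR.iteratedCohomology' n q ≅ hS.iteratedCohomology' n q)
  total : ∀ (hR : R.IsDoubleComplex) (hS : S.IsDoubleComplex) (k : ℕ),
    Nonempty (hR.totalCohomology k ≅ hS.totalCohomology k)

end Rectangle

end Rectangle

/-! ### Partitionable spaces and structural spaces -/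

section Structural

variable (P : Type) (𝒞 : Type (u + 1)) [Category.{u} 𝒞] {FC : 𝒞 → 𝒞 → Type u} {CC : 𝒞 → Type u}
  [∀ A B, FunLike (FC A B) (CC A) (CC B)] [ConcreteCategory 𝒞 FC]

/-- A partitionable space whose fixed neighborhoods are labelled by `P` and carry algebraic
structures of the kind `𝒞`: a topological space partitioned into the fixed neighborhoods
`nbhd p`, each of which is a neighborhood of all its points, together with a structure map,
which endows each `nbhd p` with the structure of an object `str p` of `𝒞`.
The labelling by `P` is the common labelling provided by the bijections between the sets of
fixed neighborhoods of the various spaces. -/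
structure PartitionableSpace where
  carrier : Type u
  [topology : TopologicalSpace carrier]
  nbhd : P → Set carrier
  nbhd_mem : ∀ p, ∀ s ∈ nbhd p, nbhd p ∈ nhds s
  existsUnique_nbhd : ∀ s, ∃! p, s ∈ nbhd p
  str : P → 𝒞
  strEquiv : ∀ p, ToType (str p) ≃ nbhd p

namespace PartitionableSpace

variable {P 𝒞}

/-- A homomorphism of structured spaces: one homomorphism for each label. -/
@[ext]
structure Hom (S T : PartitionableSpace P 𝒞) where
  app : ∀ p, S.str p ⟶ T.str p

instance : Category (PartitionableSpace P 𝒞) where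
  Hom := Hom
  id S := ⟨fun p => 𝟙 (S.str p)⟩
  comp f g := ⟨fun p => f.app p ≫ g.app p⟩

variable (P 𝒞) in
/-- The `p`-th fixed neighborhood, as a functor. -/
def component (p : P) : PartitionableSpace P 𝒞 ⥤ 𝒞 where
  obj S := S.str p
  map f := f.app p

/-- The label of the fixed neighborhood which contains a point. -/
def label (S : PartitionableSpace P 𝒞) (s : S.carrier) : P :=
  (S.existsUnique_nbhd s).choose

lemma mem_nbhd_label (S : PartitionableSpace P 𝒞) (s : S.carrier) :
    s ∈ S.nbhd (S.label s) :=
  (S.existsUnique_nbhd s).choose_spec.1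

/-- The map on points given by a homomorphism. -/
def onPoints {S T : PartitionableSpace P 𝒞} (f : S ⟶ T) (s : S.carrier) : T.carrier :=
  T.strEquiv (S.label s)
    (ConcreteCategory.hom (f.app (S.label s)) ((S.strEquiv (S.label s)).symm ⟨s, S.mem_nbhd_label s⟩))

lemma label_eq (S : PartitionableSpace P 𝒞) {s : S.carrier} {p : P} (h : s ∈ S.nbhd p) :
    S.label s = p :=
  (S.existsUnique_nbhd s).unique (S.mem_nbhd_label s) h

lemma onPoints_eq {S T : PartitionableSpace P 𝒞} (f : S ⟶ T) {s : S.carrier} {p : P}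
    (h : s ∈ S.nbhd p) :
    onPoints f s = T.strEquiv p (ConcreteCategory.hom (f.app p) ((S.strEquiv p).symm ⟨s, h⟩)) := by
  obtain rfl := S.label_eq h
  rfl

lemma onPoints_comp {S T Q : PartitionableSpace P 𝒞} (f : S ⟶ T) (g : T ⟶ Q) (s : S.carrier) :
    onPoints (f ≫ g) s = onPoints g (onPoints f s) := by
  have h := S.mem_nbhd_label s
  rw [onPoints_eq (f ≫ g) h, onPoints_eq f h, onPoints_eq g (Subtype.coe_prop _)]
  simp only [Subtype.coe_eta, Equiv.symm_apply_apply]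
  exact congrArg (fun z => (Q.strEquiv (S.label s) z : Q.carrier))
    (ConcreteCategory.comp_apply (f.app _) (g.app _) _)

end PartitionableSpace

/-- The restriction maps on the points of the values of a presheaf with values in the
category of partitionable spaces. -/
def restrictPoint {P : Type} {𝒞 : Type (u + 1)} [Category.{u} 𝒞] {FC : 𝒞 → 𝒞 → Type u}
    {CC : 𝒞 → Type u} [∀ A B, FunLike (FC A B) (CC A) (CC B)] [ConcreteCategory 𝒞 FC]
    {X : TopCat.{u}} (F : (Opens X)ᵒᵖ ⥤ PartitionableSpace P 𝒞) {U W : Opens X} (h : U ≤ W)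
    (s : (F.obj (op W)).carrier) : (F.obj (op U)).carrier :=
  PartitionableSpace.onPoints (F.map (homOfLE h).op) s

lemma restrictPoint_trans {P : Type} {𝒞 : Type (u + 1)} [Category.{u} 𝒞] {FC : 𝒞 → 𝒞 → Type u}
    {CC : 𝒞 → Type u} [∀ A B, FunLike (FC A B) (CC A) (CC B)] [ConcreteCategory 𝒞 FC]
    {X : TopCat.{u}} (F : (Opens X)ᵒᵖ ⥤ PartitionableSpace P 𝒞) {U V W : Opens X} (h : U ≤ V)
    (h' : V ≤ W) (s : (F.obj (op W)).carrier) :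
    restrictPoint F h (restrictPoint F h' s) = restrictPoint F (h.trans h') s := by
  unfold restrictPoint
  rw [← PartitionableSpace.onPoints_comp, ← F.map_comp]

/-- A structural space: a topological space with a sheaf of partitionable spaces, that is, a
presheaf satisfying locality and gluing for the points of its values.
The covers are indexed by nonempty types: the cover of the empty set by no set is not considered,
since otherwise `F(∅)` would be a point, and there would be only one label. -/
structure StructuralSpace where
  space : TopCat.{u}
  presheaf : (Opens space)ᵒᵖ ⥤ PartitionableSpace P 𝒞
  locality : ∀ {ι : Type u} [Nonempty ι] (U : ι → Opens space) (W : Opens space)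
    (hW : ⨆ i, U i = W) (s t : (presheaf.obj (op W)).carrier),
    (∀ i, restrictPoint presheaf ((le_iSup U i).trans hW.le) s =
      restrictPoint presheaf ((le_iSup U i).trans hW.le) t) → s = t
  gluing : ∀ {ι : Type u} [Nonempty ι] (U : ι → Opens space) (W : Opens space)
    (hW : ⨆ i, U i = W) (s : ∀ i, (presheaf.obj (op (U i))).carrier),
    (∀ i j, restrictPoint presheaf (inf_le_left : U i ⊓ U j ≤ U i) (s i) =
      restrictPoint presheaf (inf_le_right : U i ⊓ U j ≤ U j) (s j)) →
    ∃ t : (presheaf.obj (op W)).carrier,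
      ∀ i, restrictPoint presheaf ((le_iSup U i).trans hW.le) t = s i

namespace StructuralSpace

variable {P 𝒞} (S : StructuralSpace P 𝒞)

/-- The presheaf `F_p`: its sections over `U` are the `p`-th fixed neighborhood of `F(U)`. -/
def component (p : P) : TopCat.Presheaf 𝒞 S.space :=
  S.presheaf ⋙ PartitionableSpace.component P 𝒞 p

/-- The sheaf associated with `F_p`. -/
def componentSheaf (p : P) [HasWeakSheafify (Opens.grothendieckTopology S.space) 𝒞] :
    TopCat.Sheaf 𝒞 S.space :=
  (presheafToSheaf (Opens.grothendieckTopology S.space) 𝒞).obj (S.component p)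

end StructuralSpace

end Structural

/-! ### Structural and semi-structural ringed spaces -/

section Ringed

variable (K : Type u) [CommRing K] (P : Type)

/-- A (`K`-linear) structural ringed space: the fixed neighborhoods are (`K`-algebras, hence) rings.
For `K = ℤ` they are arbitrary rings. -/
abbrev StructuralRingedSpace := StructuralSpace P (AlgCat.{u} K)

/-- A semi-structural ringed space: a topological space which is the union of the underlying
spaces of the ringed spaces `(piece p, sheaf p)`, for `p` in `P`. -/
structure SemiStructuralRingedSpace where
  space : TopCat.{u}
  piece : P → Set space
  iUnion_piece : ⋃ p, piece p = Set.univ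
  sheaf : ∀ p, TopCat.Sheaf (AlgCat.{u} K) (TopCat.of (piece p))

variable {K P}

/-- The ringed spaces of which a semi-structural ringed space is the union. -/
def SemiStructuralRingedSpace.ringedSpace (Y : SemiStructuralRingedSpace K P) (p : P) :
    LinearRingedSpace K :=
  ⟨TopCat.of (Y.piece p), Y.sheaf p⟩

namespace StructuralRingedSpace

variable (S : StructuralRingedSpace K P)

/-- The ringed space `(X, F̃_p)`. -/
def ringedSpace (p : P) : LinearRingedSpace K :=
  ⟨S.space, S.componentSheaf p⟩

variable (P) in
/-- The subspace of the pairs with label `p` in the disjoint union of copies of `X`. -/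
def copy (X : TopCat.{u}) (p : P) : Set (Σ _ : P, X) := {y | y.1 = p}

/-- The map `x ↦ (x, p)`. -/
def relabel (X : TopCat.{u}) (p : P) : X ⟶ TopCat.of (copy P X p) :=
  TopCat.ofHom ⟨fun x => ⟨⟨p, x⟩, rfl⟩, Continuous.subtype_mk (continuous_sigmaMk (σ := fun _ : P => X)) _⟩

/-- The disjoint union `X̃` of the ringed spaces `(X, F̃_p)`: its pieces are the spaces of the
pairs `(x, p)` with `p` fixed, with the sheaf `F̃_p`. -/
def disjointUnion : SemiStructuralRingedSpace K P where
  space := TopCat.of (Σ _ : P, S.space)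
  piece := copy P S.space
  iUnion_piece := by
    ext y
    simp [copy]
  sheaf p := ((S.ringedSpace p).map (relabel S.space p)).sheaf

/-- The rows of the square/rectangle of a structural ringed space: the Hochschild complexes of
the ringed spaces `(X, F̃_p)`, in the given order. -/
abbrev rows (ord : RowOrder P) : ℕ → CochainComplex (ModuleCat.{u + 1} K) ℕ :=
  ord.row fun p => (S.ringedSpace p).hochschild

end StructuralRingedSpace

/-- The rows of the square/rectangle of a semi-structural ringed space: the Hochschild complexes of
its pieces, in the given order. -/
abbrev SemiStructuralRingedSpace.rows (Y : SemiStructuralRingedSpace K P) (ord : RowOrder P) :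
    ℕ → CochainComplex (ModuleCat.{u + 1} K) ℕ :=
  ord.row fun p => (Y.ringedSpace p).hochschild

/-- The isomorphism `e` between the Hochschild complexes of two linear categories is the one given
by the functor `Φ`: the cochain `c'` corresponding to a cochain `c` is determined by
`Φ (c' (f₁, …, fₙ)) = c (Φ f₁, …, Φ fₙ)`. -/
def IsInducedBy {𝒜 : Type v} [Category.{w} 𝒜] [Preadditive 𝒜] [Linear K 𝒜] {ℬ : Type v}
    [Category.{w} ℬ] [Preadditive ℬ] [Linear K ℬ] (Φ : 𝒜 ⥤ ℬ)
    (e : hochschildComplex 𝒜 K ≅ hochschildComplex ℬ K) : Prop :=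
  ∀ (n : ℕ) (c : HochschildCochain ℬ K n) (A : Fin (n + 1) → 𝒜)
    (f : ∀ i : Fin n, A i.castSucc ⟶ A i.succ),
    Φ.map ((show HochschildCochain 𝒜 K n from (e.inv.f n).hom c) A f) =
      c (fun i => Φ.obj (A i)) (fun i => Φ.map (f i))

end Ringed

/-! ### Structural schemes -/

section Scheme

open AlgebraicGeometry

variable {P : Type}

namespace StructuralSpace

/-- A structural locally ringed space: the stalks of the sheaf have only local rings as
fixed neighborhoods. A direct limit of structured spaces is formed for each label separately, so
the `p`-th fixed neighborhood of the stalk is the stalk of `F_p`. -/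
def IsLocallyRinged (S : StructuralSpace P CommRingCat.{u}) : Prop :=
  ∀ (p : P) (x : S.space), IsLocalRing ((S.component p).stalk x)

/-- The locally ringed space `(X, F̃_p)`. -/
def locallyRingedSpace (S : StructuralSpace P CommRingCat.{u}) (h : S.IsLocallyRinged) (p : P) :
    LocallyRingedSpace.{u} where
  carrier := S.space
  presheaf := (S.componentSheaf p).obj
  IsSheaf := (S.componentSheaf p).property
  isLocalRing x := by
    have : IsLocalRing ((TopCat.Presheaf.stalkFunctor CommRingCat.{u} x).obj (S.component p)) :=
      h p x
    have := TopCat.Presheaf.stalkFunctor_map_unit_toSheafify_isIso x CommRingCat.{u}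
      (S.component p)
    exact (asIso ((TopCat.Presheaf.stalkFunctor CommRingCat.{u} x).map
      (CategoryTheory.toSheafify (Opens.grothendieckTopology S.space)
        (S.component p)))).commRingCatIsoToRingEquiv.isLocalRing

lemma functor_iSup {X : TopCat.{u}} (V : Opens X) {ι : Type u} (U : ι → Opens V) {W : Opens V}
    (hW : ⨆ i, U i = W) :
    ⨆ i, V.isOpenEmbedding.isOpenMap.functor.obj (U i) =
      V.isOpenEmbedding.isOpenMap.functor.obj W := by
  subst hW
  apply le_antisymm
  · exact iSup_le fun i => Set.image_mono (le_iSup U i)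
  · rintro _ ⟨y, hy, rfl⟩
    obtain ⟨i, hi⟩ := Opens.mem_iSup.1 hy
    exact Opens.mem_iSup.2 ⟨i, y, hi, rfl⟩

lemma functor_inf {X : TopCat.{u}} (V : Opens X) (U U' : Opens V) :
    V.isOpenEmbedding.isOpenMap.functor.obj U ⊓ V.isOpenEmbedding.isOpenMap.functor.obj U' ≤
      V.isOpenEmbedding.isOpenMap.functor.obj (U ⊓ U') := by
  rintro _ ⟨⟨y, hy, rfl⟩, ⟨z, hz, hzy⟩⟩
  obtain rfl : z = y := V.isOpenEmbedding.injective hzy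
  exact ⟨z, ⟨hy, hz⟩, rfl⟩

/-- The restriction of a structural space to an open subset. -/
def restrict (S : StructuralSpace P CommRingCat.{u}) (V : Opens S.space) :
    StructuralSpace P CommRingCat.{u} where
  space := TopCat.of V
  presheaf := V.isOpenEmbedding.isOpenMap.functor.op ⋙ S.presheaf
  locality U W hW s t hst :=
    S.locality (fun i => V.isOpenEmbedding.isOpenMap.functor.obj (U i))
      (V.isOpenEmbedding.isOpenMap.functor.obj W) (functor_iSup V U hW) s t hst
  gluing U W hW s hs :=
    S.gluing (fun i => V.isOpenEmbedding.isOpenMap.functor.obj (U i))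
      (V.isOpenEmbedding.isOpenMap.functor.obj W) (functor_iSup V U hW) s
      (fun i j => by
        have hij := congrArg (restrictPoint S.presheaf (functor_inf V (U i) (U j))) (hs i j)
        exact (restrictPoint_trans S.presheaf (functor_inf V (U i) (U j))
          (V.isOpenEmbedding.isOpenMap.functor.map (homOfLE inf_le_left)).le (s i)).symm.trans
          (hij.trans (restrictPoint_trans S.presheaf (functor_inf V (U i) (U j))
          (V.isOpenEmbedding.isOpenMap.functor.map (homOfLE inf_le_right)).le (s j))))

/-- A structural affine scheme: a structural locally ringed space such that each of the
locally ringed spaces `(X, F̃_p)` is isomorphic to the spectrum of a ring. -/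
def IsAffine (S : StructuralSpace P CommRingCat.{u}) : Prop :=
  ∃ h : S.IsLocallyRinged, ∀ p, ∃ R : CommRingCat.{u},
    Nonempty (S.locallyRingedSpace h p ≅ Spec.toLocallyRingedSpace.obj (op R))

end StructuralSpace

variable (P) in
/-- A structural scheme: a structural locally ringed space which is covered by open subsets that
are structural affine schemes. -/
structure StructuralScheme extends StructuralSpace P CommRingCat.{u} where
  isLocallyRinged : toStructuralSpace.IsLocallyRinged
  exists_affine : ∀ x : space, ∃ V : Opens space, x ∈ V ∧ (toStructuralSpace.restrict V).IsAffine

/-- A locally ringed space is a scheme. -/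
def IsScheme (Y : LocallyRingedSpace.{u}) : Prop :=
  ∀ x : Y, ∃ (U : OpenNhds x) (R : CommRingCat.{u}),
    Nonempty (Y.restrict U.isOpenEmbedding ≅ Spec.toLocallyRingedSpace.obj (op R))

variable (P) in
/-- A `K`-structural scheme: each of the locally ringed spaces of its decomposition is
over `Spec K`. -/
structure StructuralSchemeOver (K : Type u) [CommRing K] extends StructuralScheme.{u} P where
  toSpec : ∀ p, toStructuralSpace.locallyRingedSpace isLocallyRinged p ⟶
    Spec.toLocallyRingedSpace.obj (op (CommRingCat.of K))

namespace StructuralSchemeOver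

variable {K : Type u} [CommRing K] (S : StructuralSchemeOver.{u} P K)

/-- The `p`-th locally ringed space of the decomposition. -/
abbrev part (p : P) : LocallyRingedSpace.{u} :=
  S.toStructuralSpace.locallyRingedSpace S.isLocallyRinged p

/-- The `p`-th scheme of the decomposition. -/
def scheme (p : P) (h : IsScheme (S.part p)) : Scheme.{u} := ⟨S.part p, h⟩

/-- The structure morphism of the `p`-th scheme. -/
def schemeToSpec (p : P) (h : IsScheme (S.part p)) : S.scheme p h ⟶ Spec (CommRingCat.of K) :=
  ⟨S.toSpec p⟩

/-- The structural scheme is separated and of finite type over `K`: so are the schemes into which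
it is decomposed. -/
def IsSeparatedOfFiniteType : Prop :=
  ∀ (p : P) (h : IsScheme (S.part p)), IsSeparated (S.schemeToSpec p h) ∧
    LocallyOfFiniteType (S.schemeToSpec p h) ∧ QuasiCompact (S.schemeToSpec p h)

end StructuralSchemeOver

/-- `Δ_* A` for an `O_Y`-module `A`, where `Δ : Y ⟶ Y ×_T Y` is the diagonal. -/
abbrev diagonalModule {Y T : Scheme.{u}} (f : Y ⟶ T) (A : Y.Modules) :
    (pullback f f).Modules :=
  (Scheme.Modules.pushforward (pullback.diagonal f)).obj A

/-- `Hom_{O_{Y ×_T Y}}(Δ_* O_Y, -)`. -/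
def homFromDiagonal {Y T : Scheme.{u}} (f : Y ⟶ T) : (pullback f f).Modules ⥤ AddCommGrpCat.{u} :=
  preadditiveCoyoneda.obj (op (diagonalModule f (SheafOfModules.unit Y.ringCatSheaf)))

instance {Y T : Scheme.{u}} (f : Y ⟶ T) : (homFromDiagonal f).Additive := by
  unfold homFromDiagonal; infer_instance

/-- The Hochschild cochain complex `RHom_{O_{Y ×_T Y}}(O_Y, A)` of `Y` over `T` with values in `A`,
computed with an injective resolution of `Δ_* A`. -/
def schemeHochschild {Y T : Scheme.{u}} (f : Y ⟶ T) {A : Y.Modules}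
    (I : InjectiveResolution (diagonalModule f A)) : CochainComplex AddCommGrpCat.{u} ℕ :=
  ((homFromDiagonal f).mapHomologicalComplex _).obj I.cocomplex

/-- The rows of the square/rectangle of a `K`-structural scheme: the Hochschild complexes of
the schemes into which it is decomposed, in the given order. -/
abbrev StructuralSchemeOver.rows {K : Type u} [CommRing K] (S : StructuralSchemeOver.{u} P K)
    (ord : RowOrder P) (h : ∀ p, IsScheme (S.part p)) {A : ∀ p, (S.scheme p (h p)).Modules}
    (I : ∀ p, InjectiveResolution (diagonalModule (S.schemeToSpec p (h p)) (A p))) :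
    ℕ → CochainComplex AddCommGrpCat.{u} ℕ :=
  ord.row fun p => schemeHochschild (S.schemeToSpec p (h p)) (I p)

end Scheme

end

end Structured

open AlgebraicGeometry Structured

/-! Zero vertical maps impose no condition beyond `d ≫ d = 0` in the rows: two consecutive arrows of
a path are either both horizontal or include a zero map. All the content is therefore in comparing
the rows and in constructing the schemes.

Ringed spaces. The map `x ↦ (x, p)` is a homeomorphism onto the `p`-th piece, whose sheaf is the
direct image, so direct image of right modules is a `K`-linear equivalence and preserves and
reflects injectives. A mere equivalence does not suffice for an isomorphism of Hochschild complexes: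
cochains are products over tuples of objects, so the argument uses a bijection on objects. It is
available because every open set is the preimage of an open set, so a module can be recovered from
its direct image up to equality, not just isomorphism (`pushforwardHomeo_obj_injective`,
`pushforwardHomeo_obj_surjective`). Restriction of cochains along a fully faithful linear functor
that is bijective on objects is then an isomorphism of cosimplicial modules
(`hochschildCosimplicialIso`). Vertical families are carried over by conjugation, and every
cohomology in question is a functor of a path complex or of the double complex
(`VertCompatible.sameCohomology`).

Schemes. Sheafification commutes with restriction to open subsets (`sheafifyRestrictIso`), so the
`p`-th space of an open structural subspace is an open subspace of the `p`-th space, and a cover by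
structural affine schemes makes each `p`-th space a scheme. Injective resolutions exist because
sheaves of modules form a Grothendieck abelian category: exactness of filtered colimits and a
separator pass from presheaves to sheaves along the sheafification adjunction. That any injective
resolution computes the derived functors is general homological algebra. -/

namespace Structured

/-! ### Squares/rectangles: trivial vertical maps and transport along row isomorphisms. -/

section Rectangle

variable {V : Type u} [Category.{v} V] [Abelian V]

namespace Rectangle

lemma trivial_isAdmissible (row : ℕ → CochainComplex V ℕ) (γ : LatticePath) :
    (Rectangle.trivial row).IsAdmissible γ := by
  intro i
  -- With `pos (i + 1)` unfolded, the claim depends only on two directions and one position, so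
  -- these can be generalized and the four cases separated.
  change (Rectangle.trivial row).arrow (γ.step i) (γ.pos i) ≫
    (Rectangle.trivial row).arrow (γ.step (i + 1)) ((γ.step i).next (γ.pos i)) = 0
  generalize γ.step i = d
  generalize γ.step (i + 1) = d'
  generalize γ.pos i = x
  cases d with
  | down => exact zero_comp
  | right =>
    cases d' with
    | down => exact comp_zero
    | right => exact (row x.1).d_comp_d _ _ _

lemma trivial_isDoubleComplex (row : ℕ → CochainComplex V ℕ) :
    (Rectangle.trivial row).IsDoubleComplex where
  vert_vert _ _ := zero_comp
  comm _ _ := comp_zero.trans zero_comp.symm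

variable {R S : Rectangle V} (e : ∀ n, R.row n ≅ S.row n)

/-- The isomorphism between entries given by isomorphisms of the rows. -/
noncomputable def entryIso (x : ℕ × ℕ) : R.entry x ≅ S.entry x :=
  (HomologicalComplex.eval V _ x.2).mapIso (e x.1)

/-- Isomorphisms of the rows are compatible with the vertical homomorphisms. -/
def VertCompatible : Prop :=
  ∀ n q, R.vert n q ≫ (e (n + 1)).hom.f q = (e n).hom.f q ≫ S.vert n q

variable {e}

/-- Conjugating the squares by the row isomorphisms reverses them; each equivalence in
`sameCohomology` then needs only one implication. -/
lemma VertCompatible.symm (he : VertCompatible e) : VertCompatible (R := S) (S := R) (fun n => (e n).symm) := by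
  intro n q
  have h := he n q
  rw [← cancel_epi ((e n).hom.f q), ← cancel_mono ((e (n + 1)).hom.f q)]
  simp only [Category.assoc, Iso.symm_hom]
  rw [← HomologicalComplex.comp_f, Iso.inv_hom_id, HomologicalComplex.id_f, Category.comp_id,
    ← HomologicalComplex.comp_f_assoc, Iso.hom_inv_id, HomologicalComplex.id_f, Category.id_comp, h]

lemma VertCompatible.arrow_comp (he : VertCompatible e) (d : Direction) (x : ℕ × ℕ) :
    R.arrow d x ≫ (entryIso e (d.next x)).hom = (entryIso e x).hom ≫ S.arrow d x := by
  cases d with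
  | right => exact ((e x.1).hom.comm x.2 (x.2 + 1)).symm
  | down => exact he x.1 x.2

/-- The `i`-th arrow of a path. -/
def pathArrow (R : Rectangle V) (γ : LatticePath) (i : ℕ) :
    R.entry (γ.pos i) ⟶ R.entry (γ.pos (i + 1)) :=
  R.arrow (γ.step i) (γ.pos i)

/-- Stated for `pathArrow`, whose target is written with `pos (i + 1)`, so that consecutive squares
along a path paste without unfolding positions. -/
lemma VertCompatible.pathArrow_comp (he : VertCompatible e) (γ : LatticePath) (i : ℕ) :
    R.pathArrow γ i ≫ (entryIso e (γ.pos (i + 1))).hom =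
      (entryIso e (γ.pos i)).hom ≫ S.pathArrow γ i :=
  he.arrow_comp (γ.step i) (γ.pos i)

/-- The entry isomorphisms slide past both arrows by naturality, and the first one is epi, so a
vanishing composite stays zero. -/
lemma VertCompatible.isAdmissible (he : VertCompatible e) {γ : LatticePath}
    (h : R.IsAdmissible γ) : S.IsAdmissible γ := by
  intro i
  have hi : R.pathArrow γ i ≫ R.pathArrow γ (i + 1) = 0 := h i
  change S.pathArrow γ i ≫ S.pathArrow γ (i + 1) = 0
  rw [← cancel_epi (entryIso e (γ.pos i)).hom, comp_zero, ← Category.assoc,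
    ← he.pathArrow_comp, Category.assoc, ← he.pathArrow_comp, ← Category.assoc, hi, zero_comp]

lemma pathComplex_d (γ : LatticePath) (h : R.IsAdmissible γ) (i : ℕ) :
    (R.pathComplex γ h).d i (i + 1) = R.pathArrow γ i :=
  CochainComplex.of_d (fun i => R.entry (γ.pos i)) (R.pathArrow γ) i

/-- The isomorphism of the complexes along an admissible path. -/
noncomputable def VertCompatible.pathComplexIso (he : VertCompatible e) {γ : LatticePath}
    (hR : R.IsAdmissible γ) (hS : S.IsAdmissible γ) : R.pathComplex γ hR ≅ S.pathComplex γ hS :=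
  HomologicalComplex.Hom.isoOfComponents (fun i => entryIso e (γ.pos i)) (by
    rintro i _ rfl
    rw [pathComplex_d, pathComplex_d]
    exact (he.pathArrow_comp γ i).symm)

lemma VertCompatible.isDoubleComplex (he : VertCompatible e) (h : R.IsDoubleComplex) : S.IsDoubleComplex where
  vert_vert n q := by
    rw [← cancel_epi ((e n).hom.f q), comp_zero, ← Category.assoc, ← he n q, Category.assoc,
      ← he (n + 1) q, ← Category.assoc, h.vert_vert, zero_comp]
  comm n q := by
    rw [← cancel_epi ((e n).hom.f q), ← Category.assoc, (e n).hom.comm, Category.assoc,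
      ← he n (q + 1), ← Category.assoc, h.comm, ← Category.assoc _ _ ((S.row (n + 1)).d q (q + 1)),
      ← he n q, Category.assoc, Category.assoc, (e (n + 1)).hom.comm]

/-- The isomorphism of double complexes. -/
noncomputable def VertCompatible.doubleComplexIso (he : VertCompatible e) (hR : R.IsDoubleComplex)
    (hS : S.IsDoubleComplex) : hR.doubleComplex ≅ hS.doubleComplex :=
  HomologicalComplex.Hom.isoOfComponents (fun n => e n) (by
    rintro n _ rfl
    dsimp only [IsDoubleComplex.doubleComplex]
    rw [CochainComplex.of_d, CochainComplex.of_d]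
    ext q
    exact (he n q).symm)

/-- Each cohomology is a functor (evaluation, flip, total complex, homology, or composites of these)
applied to the isomorphism of path complexes or of double complexes. -/
lemma VertCompatible.sameCohomology (he : VertCompatible e) [HasCoproducts.{0} V] : SameCohomology R S where
  isAdmissible_iff _ := ⟨he.isAdmissible, he.symm.isAdmissible⟩
  square _ hR hS i :=
    ⟨(HomologicalComplex.homologyFunctor V _ i).mapIso (he.pathComplexIso hR hS)⟩
  isDoubleComplex_iff := ⟨he.isDoubleComplex, he.symm.isDoubleComplex⟩
  horizontal hR hS n q :=
    ⟨(HomologicalComplex.eval _ _ n ⋙ HomologicalComplex.homologyFunctor V _ q).mapIso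
      (he.doubleComplexIso hR hS)⟩
  vertical hR hS n q :=
    ⟨(HomologicalComplex₂.flipFunctor V _ _ ⋙ HomologicalComplex.eval _ _ q ⋙
      HomologicalComplex.homologyFunctor V _ n).mapIso (he.doubleComplexIso hR hS)⟩
  iterated hR hS n q :=
    ⟨(HomologicalComplex.homologyFunctor _ _ n ⋙ HomologicalComplex.homologyFunctor V _ q).mapIso
      (he.doubleComplexIso hR hS)⟩
  iterated' hR hS n q :=
    ⟨(HomologicalComplex₂.flipFunctor V _ _ ⋙ HomologicalComplex.homologyFunctor _ _ q ⋙
      HomologicalComplex.homologyFunctor V _ n).mapIso (he.doubleComplexIso hR hS)⟩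
  total hR hS k :=
    ⟨(HomologicalComplex.homologyFunctor V _ k).mapIso
      (HomologicalComplex₂.total.mapIso (he.doubleComplexIso hR hS) (ComplexShape.up ℕ))⟩

/-- Transport of vertical homomorphisms along isomorphisms of the rows. -/
noncomputable def verticalFamilyEquiv {row row' : ℕ → CochainComplex V ℕ}
    (e : ∀ n, row n ≅ row' n) : VerticalFamily row ≃ VerticalFamily row' :=
  Equiv.piCongrRight fun n => Equiv.piCongrRight fun q =>
    Iso.homCongr ((HomologicalComplex.eval V _ q).mapIso (e n))
      ((HomologicalComplex.eval V _ q).mapIso (e (n + 1)))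

lemma verticalFamilyEquiv_apply {row row' : ℕ → CochainComplex V ℕ}
    (e : ∀ n, row n ≅ row' n) (W : VerticalFamily row) (n q : ℕ) :
    verticalFamilyEquiv e W n q = (e n).inv.f q ≫ W n q ≫ (e (n + 1)).hom.f q :=
  rfl

lemma verticalFamilyEquiv_zero {row row' : ℕ → CochainComplex V ℕ} (e : ∀ n, row n ≅ row' n) :
    (verticalFamilyEquiv e fun _ _ => 0) = fun _ _ => 0 := by
  funext n q
  rw [verticalFamilyEquiv_apply, zero_comp, comp_zero]

lemma comp_verticalFamilyEquiv {row row' : ℕ → CochainComplex V ℕ} (e : ∀ n, row n ≅ row' n)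
    (W : VerticalFamily row) (n q : ℕ) :
    W n q ≫ (e (n + 1)).hom.f q = (e n).hom.f q ≫ verticalFamilyEquiv e W n q := by
  rw [verticalFamilyEquiv_apply, ← HomologicalComplex.comp_f_assoc, Iso.hom_inv_id,
    HomologicalComplex.id_f, Category.id_comp]

lemma sameCohomology_verticalFamilyEquiv [HasCoproducts.{0} V]
    {row row' : ℕ → CochainComplex V ℕ} (e : ∀ n, row n ≅ row' n) (W : VerticalFamily row) :
    SameCohomology ⟨row, W⟩ ⟨row', verticalFamilyEquiv e W⟩ :=
  VertCompatible.sameCohomology (R := ⟨row, W⟩) (S := ⟨row', verticalFamilyEquiv e W⟩) (e := e)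
    (comp_verticalFamilyEquiv e W)

end Rectangle

end Rectangle

end Structured

namespace Structured

/-! ### Hochschild complexes and linear functors bijective on objects. -/

section HochschildFunctoriality

lemma chainComp_map {𝒜 : Type v} [Category.{w} 𝒜] {ℬ : Type v} [Category.{w} ℬ] (Φ : 𝒜 ⥤ ℬ) {n : ℕ} {A : Fin (n + 1) → 𝒜}
    (f : ∀ i : Fin n, A i.castSucc ⟶ A i.succ) {a b : Fin (n + 1)} (h : a ≤ b) :
    chainComp (A := fun i => Φ.obj (A i)) (fun i => Φ.map (f i)) h = Φ.map (chainComp f h) := by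
  induction b using Fin.induction with
  | zero =>
    obtain rfl : a = 0 := le_antisymm h (Fin.zero_le _)
    rw [chainComp_self, chainComp_self, Φ.map_id]
  | succ b ih =>
    rcases h.eq_or_lt with rfl | hlt
    · rw [chainComp_self, chainComp_self, Φ.map_id]
    · have hab : a ≤ b.castSucc := Fin.le_castSucc_iff.2 hlt
      have hb : b.castSucc ≤ b.succ := Fin.castSucc_lt_succ.le
      rw [← chainComp_comp f hab hb, ← chainComp_comp _ hab hb, chainComp_succ, ih hab,
        Φ.map_comp, chainComp_succ]

variable {K : Type u} [CommRing K] {𝒜 : Type v} [Category.{w} 𝒜] [Preadditive 𝒜] [Linear K 𝒜]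
  {ℬ : Type v} [Category.{w} ℬ] [Preadditive ℬ] [Linear K ℬ]

variable (K)

/-- The action of a fully faithful linear functor on morphisms. -/
noncomputable def homLinearEquiv (Φ : 𝒜 ⥤ ℬ) [Φ.Additive] [Φ.Linear K] [Φ.Full] [Φ.Faithful]
    (X Y : 𝒜) : (X ⟶ Y) ≃ₗ[K] (Φ.obj X ⟶ Φ.obj Y) :=
  LinearEquiv.ofBijective (Φ.mapLinearMap K) ⟨Φ.map_injective, Φ.map_surjective⟩

/-- Restriction of cochains along a fully faithful linear functor. -/
noncomputable def cochainRestrict (Φ : 𝒜 ⥤ ℬ) [Φ.Additive] [Φ.Linear K] [Φ.Full] [Φ.Faithful]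
    (n : ℕ) : HochschildCochain ℬ K n →ₗ[K] HochschildCochain 𝒜 K n where
  toFun c A := (homLinearEquiv K Φ (A 0) (A (Fin.last n))).symm.toLinearMap.compMultilinearMap
    ((c fun i => Φ.obj (A i)).compLinearMap fun _ => Φ.mapLinearMap K)
  map_add' c d := by
    ext A f
    exact map_add (homLinearEquiv K Φ (A 0) (A (Fin.last n))).symm _ _
  map_smul' r c := by
    ext A f
    exact map_smul (homLinearEquiv K Φ (A 0) (A (Fin.last n))).symm r _

variable {K}

variable (Φ : 𝒜 ⥤ ℬ) [Φ.Additive] [Φ.Linear K] [Φ.Full] [Φ.Faithful]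

lemma map_cochainRestrict {n : ℕ} (c : HochschildCochain ℬ K n) (A : Fin (n + 1) → 𝒜)
    (f : ∀ i : Fin n, A i.castSucc ⟶ A i.succ) :
    Φ.map (cochainRestrict K Φ n c A f) = c (fun i => Φ.obj (A i)) (fun i => Φ.map (f i)) :=
  (homLinearEquiv K Φ (A 0) (A (Fin.last n))).apply_symm_apply _

/-- As `Φ` is faithful, the identity may be tested after applying `Φ`, which preserves composites of
chains. Treating all monotone maps at once keeps the signs of the coboundary out of the argument. -/
lemma cochainRestrict_hochschildMap {m n : ℕ} (θ : Fin (m + 1) →o Fin (n + 1))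
    (c : HochschildCochain ℬ K m) :
    cochainRestrict K Φ n (hochschildMap θ c) = hochschildMap θ (cochainRestrict K Φ m c) := by
  ext A f
  apply Φ.map_injective
  rw [map_cochainRestrict]
  change hochschildMapFun θ c (fun i => Φ.obj (A i)) (fun i => Φ.map (f i)) = Φ.map (hochschildMapFun θ (cochainRestrict K Φ m c) A f)
  unfold hochschildMapFun
  rw [Φ.map_comp, Φ.map_comp, map_cochainRestrict, chainComp_map, chainComp_map]
  congr! 4
  exact chainComp_map Φ f _

/-- Surjectivity on objects and fullness lift every chain of arrows of `ℬ` to `𝒜`, so a cochain is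
determined by its values on images of chains. -/
lemma cochainRestrict_injective (hΦ : Function.Surjective Φ.obj) (n : ℕ) :
    Function.Injective (cochainRestrict K Φ n) := by
  intro c d h
  ext A f
  obtain ⟨A, rfl⟩ : ∃ A' : Fin (n + 1) → 𝒜, (fun i => Φ.obj (A' i)) = A :=
    ⟨fun i => (hΦ (A i)).choose, funext fun i => (hΦ (A i)).choose_spec⟩
  obtain ⟨f, rfl⟩ : ∃ f' : ∀ i : Fin n, A i.castSucc ⟶ A i.succ, (fun i => Φ.map (f' i)) = f :=
    ⟨fun i => Φ.preimage (f i), funext fun i => Φ.map_preimage (f i)⟩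
  rw [← map_cochainRestrict, ← map_cochainRestrict, h]

lemma cochainRestrict_surjective (hΦ : Function.Bijective Φ.obj) (n : ℕ) :
    Function.Surjective (cochainRestrict K Φ n) := by
  intro c
  -- The extension is built separately on each tuple of objects, but a tuple is only propositionally
  -- equal to the image of its lift. Quantifying over all lifts, with a transport along `h`, allows
  -- `h` to be `rfl` when the property is finally used.
  have key : ∀ A : Fin (n + 1) → ℬ,
      ∃ d : MultilinearMap K (fun i : Fin n => (A i.castSucc ⟶ A i.succ)) (A 0 ⟶ A (Fin.last n)),
        ∀ (A' : Fin (n + 1) → 𝒜) (h : A = fun i => Φ.obj (A' i))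
          (f : ∀ i : Fin n, A' i.castSucc ⟶ A' i.succ),
          (Eq.rec (motive := fun B _ => MultilinearMap K
            (fun i : Fin n => (B i.castSucc ⟶ B i.succ)) (B 0 ⟶ B (Fin.last n))) d h)
            (fun i => Φ.map (f i)) = Φ.map (c A' f) := by
    intro A
    obtain ⟨A, rfl⟩ : ∃ A' : Fin (n + 1) → 𝒜, (fun i => Φ.obj (A' i)) = A :=
      ⟨fun i => (hΦ.2 (A i)).choose, funext fun i => (hΦ.2 (A i)).choose_spec⟩
    refine ⟨(homLinearEquiv K Φ _ _).toLinearMap.compMultilinearMap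
      ((c A).compLinearMap fun i => (homLinearEquiv K Φ _ _).symm.toLinearMap), ?_⟩
    intro A' h f
    -- Injectivity on objects makes the lift unique, so the transport disappears.
    obtain rfl : A = A' := funext fun i => hΦ.1 (congrFun h i)
    change homLinearEquiv K Φ _ _ (c A fun i => (homLinearEquiv K Φ _ _).symm
      (homLinearEquiv K Φ _ _ (f i))) = _
    simp only [LinearEquiv.symm_apply_apply]
    rfl
  choose d hd using key
  refine ⟨d, ?_⟩
  ext A f
  apply Φ.map_injective
  rw [map_cochainRestrict]
  exact hd _ A rfl f

/-- A fully faithful linear functor which is bijective on objects induces an isomorphism of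
the cosimplicial modules of Hochschild cochains. -/
noncomputable def hochschildCosimplicialIso (hΦ : Function.Bijective Φ.obj) :
    hochschildCosimplicial 𝒜 K ≅ hochschildCosimplicial ℬ K :=
  -- Restriction runs from cochains on `ℬ` to cochains on `𝒜`, hence the inversion at the end.
  (NatIso.ofComponents (fun n => (LinearEquiv.ofBijective (cochainRestrict K Φ n.len)
    ⟨cochainRestrict_injective Φ hΦ.2 _, cochainRestrict_surjective Φ hΦ _⟩).toModuleIso)
    (fun θ => by
      ext c : 2
      exact cochainRestrict_hochschildMap Φ θ.toOrderHom c)).symm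

/-- A fully faithful linear functor which is bijective on objects induces an isomorphism of
Hochschild complexes. -/
noncomputable def hochschildComplexIso (hΦ : Function.Bijective Φ.obj) :
    hochschildComplex 𝒜 K ≅ hochschildComplex ℬ K :=
  (AlgebraicTopology.alternatingCofaceMapComplex _).mapIso (hochschildCosimplicialIso Φ hΦ)

lemma hochschildComplexIso_isInducedBy (hΦ : Function.Bijective Φ.obj) :
    IsInducedBy Φ (hochschildComplexIso (K := K) Φ hΦ) := fun _ c A f =>
  map_cochainRestrict Φ c A f

end HochschildFunctoriality

end Structured

/-! ### Modules form Grothendieck abelian categories. -/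

namespace PresheafOfModules

variable {C : Type u} [SmallCategory C] (R : Cᵒᵖ ⥤ RingCat.{u})

/-- Filtered colimits and finite limits are computed on the underlying presheaves of abelian groups,
where they commute. -/
instance : AB5OfSize.{u, u} (PresheafOfModules.{u} R) where
  ofShape J _ _ := HasExactColimitsOfShape.domain_of_functor J (toPresheaf.{u} R)

/-- The free modules on representables detect sections; their coproduct is a single separator. -/
instance : HasSeparator (PresheafOfModules.{u} R) where
  hasSeparator := ⟨_, ObjectProperty.IsSeparating.isSeparator_coproduct (freeYoneda.isSeparating R)⟩

instance : IsGrothendieckAbelian.{u} (PresheafOfModules.{u} R) where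

end PresheafOfModules

/-- Maps out of `F.obj X` are maps from `X` into values of the faithful functor `G`. This carries
the separator from presheaves to sheaves. -/
lemma CategoryTheory.Adjunction.isSeparator {C : Type u} [Category.{v} C] {D : Type w}
    [Category.{v} D] {F : C ⥤ D} {G : D ⥤ C} (adj : F ⊣ G) [G.Faithful] {X : C}
    (hX : IsSeparator X) : IsSeparator (F.obj X) := by
  rw [isSeparator_def]
  intro Y Z f g h
  apply G.map_injective
  refine hX.def _ _ fun a => ?_
  apply (adj.homEquiv _ _).symm.injective
  rw [adj.homEquiv_naturality_right_symm, adj.homEquiv_naturality_right_symm, h]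

namespace SheafOfModules

variable {C : Type u} [SmallCategory C] {J : GrothendieckTopology C} (R : Sheaf J RingCat.{u})
  [HasSheafify J AddCommGrpCat.{u}] [J.WEqualsLocallyBijective AddCommGrpCat.{u}]

instance : AB5OfSize.{u, u} (SheafOfModules.{u} R) where
  ofShape K _ _ :=
    (PresheafOfModules.sheafificationAdjunction (𝟙 R.obj)).hasExactColimitsOfShape K

instance : IsGrothendieckAbelian.{u} (SheafOfModules.{u} R) where
  hasSeparator :=
    ⟨_, (PresheafOfModules.sheafificationAdjunction (𝟙 R.obj)).isSeparator
      (isSeparator_separator _)⟩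

end SheafOfModules

instance (X : Scheme.{u}) : IsGrothendieckAbelian.{u} X.Modules :=
  inferInstanceAs (IsGrothendieckAbelian.{u} (SheafOfModules.{u} X.ringCatSheaf))

/-! ### Restriction of structural schemes to open subsets. -/

/-- The functor on open sets attached to an open map is cocontinuous. -/
lemma IsOpenMap.isCocontinuous_functor {X Y : TopCat.{u}} {f : X ⟶ Y} (hf : IsOpenMap f) :
    hf.functor.IsCocontinuous (Opens.grothendieckTopology X) (Opens.grothendieckTopology Y) where
  cover_lift := by
    rintro U S hS x hx
    obtain ⟨W, i, hW, hxW⟩ := hS (f x) ⟨x, hx, rfl⟩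
    -- The preimage of `W` is cut down to `U`; its image lies in `W`, hence in the sieve.
    refine ⟨U ⊓ (Opens.map f).obj W, homOfLE inf_le_left, ?_, ⟨hx, hxW⟩⟩
    have hle : hf.functor.obj (U ⊓ (Opens.map f).obj W) ≤ W := by
      rintro _ ⟨y, ⟨-, hy⟩, rfl⟩
      exact hy
    exact S.downward_closed hW (homOfLE hle)

namespace Structured

variable {P : Type}

/-- Sheafification commutes with restriction along open embeddings. -/
noncomputable def sheafifyRestrictIso {X Y : TopCat.{u}} {f : X ⟶ Y}
    (hf : Topology.IsOpenEmbedding f) (F : (Opens Y)ᵒᵖ ⥤ CommRingCat.{u}) :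
    ((presheafToSheaf (Opens.grothendieckTopology X) CommRingCat.{u}).obj
      (hf.isOpenMap.functor.op ⋙ F)).obj ≅
    hf.isOpenMap.functor.op ⋙
      ((presheafToSheaf (Opens.grothendieckTopology Y) CommRingCat.{u}).obj F).obj :=
  haveI : hf.isOpenMap.functor.IsContinuous (Opens.grothendieckTopology X)
    (Opens.grothendieckTopology Y) := hf.functor_isContinuous
  haveI := hf.isOpenMap.isCocontinuous_functor
  -- Continuity makes restriction preserve sheaves; cocontinuity makes it compatible with
  -- sheafification.
  (sheafToPresheaf (Opens.grothendieckTopology X) CommRingCat.{u}).mapIso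
    ((hf.isOpenMap.functor.pushforwardContinuousSheafificationCompatibility
      CommRingCat.{u} (Opens.grothendieckTopology X) (Opens.grothendieckTopology Y)).app F)

/-- The decomposition of an open structural subspace. -/
noncomputable def StructuralSpace.locallyRingedSpaceRestrictIso
    (S : StructuralSpace P CommRingCat.{u}) (h : S.IsLocallyRinged) (V : Opens S.space)
    (hV : (S.restrict V).IsLocallyRinged) (p : P) :
    (S.restrict V).locallyRingedSpace hV p ≅
      (S.locallyRingedSpace h p).restrict V.isOpenEmbedding :=
  LocallyRingedSpace.isoOfSheafedSpaceIso
    (SheafedSpace.isoMk (PresheafedSpace.isoOfComponents (Iso.refl _)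
      (sheafifyRestrictIso V.isOpenEmbedding (S.component p))))

/-- One structural affine neighbourhood of `x` serves every label: its `p`-th space is the spectrum
of a ring and is also an open subspace of the `p`-th space. -/
lemma StructuralScheme.isScheme_locallyRingedSpace (S : StructuralScheme.{u} P) (p : P) :
    IsScheme (S.toStructuralSpace.locallyRingedSpace S.isLocallyRinged p) := by
  intro x
  obtain ⟨V, hx, hV, hR⟩ := S.exists_affine x
  obtain ⟨R, ⟨e⟩⟩ := hR p
  exact ⟨⟨V, hx⟩, R,
    ⟨(S.toStructuralSpace.locallyRingedSpaceRestrictIso S.isLocallyRinged V hV p).symm ≪≫ e⟩⟩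

end Structured

/-! ### Equality of presheaves of modules. -/

namespace PresheafOfModules

variable {C : Type u} [Category.{v} C] {R : Cᵒᵖ ⥤ RingCat.{w}}

lemma ext_of_heq {M N : PresheafOfModules.{w} R} (hobj : ∀ U, M.obj U = N.obj U)
    (hmap : ∀ {U V : Cᵒᵖ} (f : U ⟶ V), M.map f ≍ N.map f) : M = N := by
  obtain ⟨Mobj, Mmap, _, _⟩ := M
  obtain ⟨Nobj, Nmap, _, _⟩ := N
  obtain rfl : Mobj = Nobj := funext hobj
  congr!
  funext U V f
  exact eq_of_heq (hmap f)

/-- Once the equal objects are identified, the scalars are restricted along the identity, which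
changes nothing definitionally. This gives the strict equality needed for bijectivity on objects. -/
lemma restrictScalars_obj_eq (N : PresheafOfModules.{w} R) {U U' : Cᵒᵖ} (h : U = U')
    (r : R.obj U ⟶ R.obj U') (hr : r = R.map (eqToHom h)) :
    (ModuleCat.restrictScalars r.hom).obj (N.obj U') = N.obj U := by
  subst h
  obtain rfl : r = 𝟙 _ := by rw [hr, eqToHom_refl, R.map_id]
  rfl

lemma restrictScalars_map_heq (N : PresheafOfModules.{w} R) {U U' V V' : Cᵒᵖ} (hU : U = U')
    (hV : V = V') (r : R.obj U ⟶ R.obj U') (hr : r = R.map (eqToHom hU))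
    (s : R.obj V ⟶ R.obj V') (hs : s = R.map (eqToHom hV)) (f : U ⟶ V) (g : U' ⟶ V')
    (hfg : f ≫ eqToHom hV = eqToHom hU ≫ g)
    (k : (ModuleCat.restrictScalars r.hom).obj (N.obj U') ⟶
      (ModuleCat.restrictScalars (R.map f).hom).obj
        ((ModuleCat.restrictScalars s.hom).obj (N.obj V')))
    (hk : ∀ x : N.obj U', (k.hom x : N.obj V') = N.map g x) : k ≍ N.map f := by
  subst hU hV
  obtain rfl : r = 𝟙 _ := by rw [hr, eqToHom_refl, R.map_id]
  obtain rfl : s = 𝟙 _ := by rw [hs, eqToHom_refl, R.map_id]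
  obtain rfl : f = g := by simpa using hfg
  apply heq_of_eq
  ext x
  exact hk x

end PresheafOfModules

/-! ### Direct image along a homeomorphism: an equivalence, bijective on objects. -/

namespace SheafOfModules

section Homeomorphism

variable {X Z : TopCat.{u}} (H : X ≅ Z) (R : Sheaf (Opens.grothendieckTopology X) RingCat.{u})

/-- Direct image of sheaves of modules along a homeomorphism. -/
noncomputable abbrev pushforwardHomeo :
    SheafOfModules.{u} R ⥤ SheafOfModules.{u} (((Opens.map H.hom).sheafPushforwardContinuous
      RingCat.{u} (Opens.grothendieckTopology Z) (Opens.grothendieckTopology X)).obj R) :=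
  pushforward (F := Opens.map H.hom) (𝟙 _)

/-- The identification of a sheaf of rings with its direct image under a homeomorphism and the
inverse homeomorphism. -/
def toPushforwardInv : R ⟶ ((Opens.map H.inv).sheafPushforwardContinuous
      RingCat.{u} (Opens.grothendieckTopology X) (Opens.grothendieckTopology Z)).obj
      (((Opens.map H.hom).sheafPushforwardContinuous
      RingCat.{u} (Opens.grothendieckTopology Z) (Opens.grothendieckTopology X)).obj R) where
  hom := Functor.whiskerRight (NatTrans.op (Opens.mapMapIso H).counit) R.obj

/-- Inverse images of open sets under a homeomorphism and its inverse are adjoint. -/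
noncomputable def opensMapAdj : Opens.map H.hom ⊣ Opens.map H.inv :=
  (Opens.mapMapIso H).toAdjunction

/-- Direct images under a homeomorphism and its inverse are adjoint. -/
noncomputable def pushforwardHomeoAdj :
    pushforwardHomeo H R ⊣ pushforward (toPushforwardInv H R) :=
  pushforwardPushforwardAdj (opensMapAdj H) _ _ (by
      ext U : 2
      exact (Category.comp_id _).symm) (by
      ext U : 2
      refine (Category.id_comp _).trans ?_
      refine (R.obj.map_comp _ _).symm.trans ?_
      -- The composite is `R` applied to an endomorphism in a poset, hence to an identity.
      exact (congrArg R.obj.map (Subsingleton.elim _ _)).trans (R.obj.map_id _))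

lemma isIso_of_isIso_app {C : Type u} [Category.{v} C] {J : GrothendieckTopology C}
    {R : Sheaf J RingCat.{w}} {M N : SheafOfModules.{w} R} (f : M ⟶ N)
    (h : ∀ U, IsIso ((forget₂ _ Ab).map (f.val.app U))) : IsIso f := by
  have : IsIso ((SheafOfModules.forget R ⋙ PresheafOfModules.toPresheaf _).map f) :=
    (NatTrans.isIso_iff_isIso_app _).2 h
  exact isIso_of_reflects_iso f (SheafOfModules.forget R ⋙ PresheafOfModules.toPresheaf _)

instance : (pushforwardHomeo H R).IsEquivalence := by
  -- On sections, the unit and counit are restrictions of `M` along isomorphisms of open sets;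
  -- contravariance exchanges the unit and counit of the adjunction of open sets.
  have h1 : ∀ M, IsIso ((pushforwardHomeoAdj H R).unit.app M) := fun M =>
    isIso_of_isIso_app _ fun U => inferInstanceAs
      (IsIso (M.val.presheaf.map ((Opens.mapMapIso H).counit.app U.unop).op))
  have h2 : ∀ M, IsIso ((pushforwardHomeoAdj H R).counit.app M) := fun M =>
    isIso_of_isIso_app _ fun U => inferInstanceAs
      (IsIso (M.val.presheaf.map ((Opens.mapMapIso H).unit.app U.unop).op))
  exact (pushforwardHomeoAdj H R).toEquivalence.isEquivalence_functor

lemma opens_map_hom_inv (U : Opens X) : (Opens.map H.hom).obj ((Opens.map H.inv).obj U) = U := by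
  ext x
  simp

lemma opens_map_inv_hom (U : Opens Z) : (Opens.map H.inv).obj ((Opens.map H.hom).obj U) = U := by
  ext x
  simp

/-- Every open set of `X` is equal to the preimage of one of `Z`, so all modules of sections and all
restriction maps already occur in the direct image. -/
lemma pushforwardHomeo_obj_injective : Function.Injective (pushforwardHomeo H R).obj := by
  intro M N h
  have hobj : ∀ U, ((pushforwardHomeo H R).obj M).val.obj U =
      ((pushforwardHomeo H R).obj N).val.obj U := fun U => by rw [h]
  have hmap : ∀ {U V : (Opens Z)ᵒᵖ} (f : U ⟶ V), ((pushforwardHomeo H R).obj M).val.map f ≍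
      ((pushforwardHomeo H R).obj N).val.map f := fun f => by rw [h]
  have key : M.val = N.val := by
    have hs : ∀ U : (Opens X)ᵒᵖ, ∃ W : (Opens Z)ᵒᵖ, op ((Opens.map H.hom).obj W.unop) = U :=
      fun U => ⟨op ((Opens.map H.inv).obj U.unop), congrArg op (opens_map_hom_inv H U.unop)⟩
    refine PresheafOfModules.ext_of_heq (fun U => ?_) (fun {U V} f => ?_)
    · obtain ⟨W, rfl⟩ := hs U
      exact hobj W
    · obtain ⟨W, rfl⟩ := hs U
      obtain ⟨W', rfl⟩ := hs V
      have hle : W'.unop ≤ W.unop := by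
        rw [← opens_map_inv_hom H W'.unop, ← opens_map_inv_hom H W.unop]
        exact ((Opens.map H.inv).map f.unop).le
      exact hmap (homOfLE hle).op
  cases M; cases N
  congr

lemma pushforwardHomeo_obj_surjective : Function.Surjective (pushforwardHomeo H R).obj := by
  intro N
  -- The preimage of `N` is its direct image under the inverse homeomorphism. Going back evaluates
  -- `N` at open sets equal to the original ones, with scalars restricted along the transport.
  refine ⟨(pushforward (toPushforwardInv H R)).obj N, ?_⟩
  have key : ((pushforwardHomeo H R).obj ((pushforward (toPushforwardInv H R)).obj N)).val =
      N.val := by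
    refine PresheafOfModules.ext_of_heq (fun U => ?_) (fun {U V} f => ?_)
    · exact PresheafOfModules.restrictScalars_obj_eq N.val
        (U' := op ((Opens.map H.inv).obj ((Opens.map H.hom).obj U.unop)))
        (congrArg op (opens_map_inv_hom H U.unop).symm) _
        (congrArg R.obj.map (Subsingleton.elim _ _))
    · exact PresheafOfModules.restrictScalars_map_heq N.val
        (U' := op ((Opens.map H.inv).obj ((Opens.map H.hom).obj U.unop)))
        (V' := op ((Opens.map H.inv).obj ((Opens.map H.hom).obj V.unop)))
        (congrArg op (opens_map_inv_hom H U.unop).symm)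
        (congrArg op (opens_map_inv_hom H V.unop).symm) _
        (congrArg R.obj.map (Subsingleton.elim _ _)) _
        (congrArg R.obj.map (Subsingleton.elim _ _)) f
        ((Opens.map H.inv).map ((Opens.map H.hom).map f.unop)).op
        (Subsingleton.elim _ _) _ (fun x => rfl)
  generalize (pushforwardHomeo H R).obj ((pushforward (toPushforwardInv H R)).obj N) = M at key
  cases M; cases N
  congr

end Homeomorphism

end SheafOfModules

/-! ### The relabelling `x ↦ (x, p)`. -/

namespace Structured

section Relabelling

variable {K : Type u} [CommRing K]

section Pushforward

variable (Y : LinearRingedSpace K) {Z : TopCat.{u}} (H : Y.space ≅ Z)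

instance : (Y.pushforwardModules H.hom).IsEquivalence :=
  inferInstanceAs (SheafOfModules.pushforwardHomeo H (oppositeSheaf Y.sheaf)).IsEquivalence

lemma pushforwardModules_obj_bijective : Function.Bijective (Y.pushforwardModules H.hom).obj :=
  ⟨SheafOfModules.pushforwardHomeo_obj_injective H (oppositeSheaf Y.sheaf),
    SheafOfModules.pushforwardHomeo_obj_surjective H (oppositeSheaf Y.sheaf)⟩

instance (j : Y.space ⟶ Z) : (Y.pushforwardModules j).Additive where
  map_add := rfl

/-- Scalars of the direct image over an open set are, by definition, scalars over its preimage. -/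
instance (j : Y.space ⟶ Z) : (Y.pushforwardModules j).Linear K where
  map_smul _ _ := rfl

/-- Direct image of injective right modules along a homeomorphism. -/
noncomputable def pushforwardInjective :
    InjectiveObject (RightModules Y.sheaf) ⥤ InjectiveObject (RightModules (Y.map H.hom).sheaf) :=
  ObjectProperty.lift _ (ObjectProperty.ι _ ⋙ Y.pushforwardModules H.hom) fun M =>
    ((Y.pushforwardModules H.hom).asEquivalence.map_injective_iff M.obj).2 M.property

instance : (pushforwardInjective Y H).Full :=
  haveI : (Y.pushforwardModules H.hom).Full := Functor.IsEquivalence.full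
  Functor.Full.of_comp_faithful_iso (G := ObjectProperty.ι _)
    (Iso.refl (ObjectProperty.ι _ ⋙ Y.pushforwardModules H.hom))

instance : (pushforwardInjective Y H).Faithful :=
  haveI : (Y.pushforwardModules H.hom).Faithful := Functor.IsEquivalence.faithful
  Functor.Faithful.of_comp_iso (G := ObjectProperty.ι _)
    (Iso.refl (ObjectProperty.ι _ ⋙ Y.pushforwardModules H.hom))

instance : (pushforwardInjective Y H).Additive where
  map_add := rfl

instance : (pushforwardInjective Y H).Linear K where
  map_smul _ _ := rfl

/-- The bijection on all modules restricts to injective ones because an equivalence both preserves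
and reflects injectivity. -/
lemma pushforwardInjective_obj_bijective : Function.Bijective (pushforwardInjective Y H).obj := by
  constructor
  · rintro ⟨M, hM⟩ ⟨N, hN⟩ h
    obtain rfl : M = N :=
      (pushforwardModules_obj_bijective Y H).1 (congrArg ObjectProperty.FullSubcategory.obj h)
    rfl
  · rintro ⟨N, hN⟩
    obtain ⟨M, rfl⟩ := (pushforwardModules_obj_bijective Y H).2 N
    exact ⟨⟨M, ((Y.pushforwardModules H.hom).asEquivalence.map_injective_iff M).1 hN⟩, rfl⟩

/-- The isomorphism of Hochschild complexes induced by a homeomorphism. -/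
noncomputable def hochschildMapIso : Y.hochschild ≅ (Y.map H.hom).hochschild :=
  hochschildComplexIso (pushforwardInjective Y H) (pushforwardInjective_obj_bijective Y H)

lemma hochschildMapIso_isInducedBy :
    IsInducedBy (pushforwardInjective Y H) (hochschildMapIso Y H) :=
  hochschildComplexIso_isInducedBy _ (pushforwardInjective_obj_bijective Y H)

lemma pushforwardInjective_comp_ι :
    pushforwardInjective Y H ⋙ ObjectProperty.ι _ =
      ObjectProperty.ι _ ⋙ Y.pushforwardModules H.hom :=
  rfl

end Pushforward

/-- The homeomorphism `x ↦ (x, p)`. -/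
def relabelIso {P : Type} (X : TopCat.{u}) (p : P) :
    X ≅ TopCat.of (StructuralRingedSpace.copy P X p) where
  hom := StructuralRingedSpace.relabel X p
  inv := TopCat.ofHom ⟨fun y => y.1.2, by
    -- Forgetting the label is continuous because it is the identity on each summand.
    refine Continuous.comp (g := fun y : Σ _ : P, X => y.2) ?_ continuous_subtype_val
    exact continuous_sigma fun _ => continuous_id⟩
  hom_inv_id := rfl
  inv_hom_id := by
    refine TopCat.hom_ext (ContinuousMap.ext ?_)
    rintro ⟨⟨q, x⟩, hq⟩
    obtain rfl : q = p := hq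
    rfl

variable {P : Type} (S : StructuralRingedSpace K P)

/-- The functor on injective modules induced by the relabelling `x ↦ (x, p)`. -/
noncomputable def relabelFunctor (p : P) : InjectiveObject (RightModules (S.ringedSpace p).sheaf) ⥤
    InjectiveObject (RightModules (S.disjointUnion.ringedSpace p).sheaf) :=
  pushforwardInjective (S.ringedSpace p) (relabelIso S.space p)

/-- The isomorphism of Hochschild complexes induced by the relabelling `x ↦ (x, p)`. -/
noncomputable def relabelHochschildIso (p : P) :
    (S.ringedSpace p).hochschild ≅ (S.disjointUnion.ringedSpace p).hochschild :=
  hochschildMapIso (S.ringedSpace p) (relabelIso S.space p)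

lemma relabelHochschildIso_isInducedBy (p : P) :
    IsInducedBy (relabelFunctor S p) (relabelHochschildIso S p) :=
  hochschildMapIso_isInducedBy (S.ringedSpace p) (relabelIso S.space p)

lemma relabelFunctor_comp_ι (p : P) :
    relabelFunctor S p ⋙ ObjectProperty.ι _ = ObjectProperty.ι _ ⋙
      (S.ringedSpace p).pushforwardModules (StructuralRingedSpace.relabel S.space p) :=
  pushforwardInjective_comp_ι (S.ringedSpace p) (relabelIso S.space p)

end Relabelling

end Structured

/-! ### The theorem. -/

theorem theorem4p1 {P : Type} (ord : RowOrder P) :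
    -- structural ringed spaces
    (∀ (K : Type u) [CommRing K] (S : StructuralRingedSpace K P),
      -- the trivial vertical homomorphisms are always possible
      (∀ γ, (Rectangle.trivial (S.rows ord)).IsAdmissible γ) ∧
      (Rectangle.trivial (S.rows ord)).IsDoubleComplex ∧
      -- comparison with the disjoint union of the ringed spaces `(X, F̃_p)`
      ∃ (Φ : ∀ p, InjectiveObject (RightModules (S.ringedSpace p).sheaf) ⥤
            InjectiveObject (RightModules (S.disjointUnion.ringedSpace p).sheaf))
          (e : ∀ p, (S.ringedSpace p).hochschild ≅ (S.disjointUnion.ringedSpace p).hochschild)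
          (T : VerticalFamily (S.rows ord) ≃ VerticalFamily (S.disjointUnion.rows ord)),
        -- `Φ p` and `e p` are the relabelling `x ↦ (x, p)`
        (∀ p, Φ p ⋙ ObjectProperty.ι _ = ObjectProperty.ι _ ⋙
          (S.ringedSpace p).pushforwardModules (StructuralRingedSpace.relabel S.space p)) ∧
        (∀ p, IsInducedBy (Φ p) (e p)) ∧
        -- it is compatible with the vertical homomorphisms
        (T fun _ _ => 0) = (fun _ _ => 0) ∧
        (∀ W n q, W n q ≫ (ord.rowIso e (n + 1)).hom.f q =
          (ord.rowIso e n).hom.f q ≫ T W n q) ∧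
        -- and the cohomologies agree
        ∀ W, Rectangle.SameCohomology ⟨S.rows ord, W⟩ ⟨S.disjointUnion.rows ord, T W⟩) ∧
    -- structural schemes
    (∀ (K : Type u) [CommRing K] [IsNoetherianRing K] (S : StructuralSchemeOver P K),
      S.IsSeparatedOfFiniteType →
      ∃ h : ∀ p, IsScheme (S.part p),
        (∀ p, IsSeparated (S.schemeToSpec p (h p)) ∧ LocallyOfFiniteType (S.schemeToSpec p (h p)) ∧
          QuasiCompact (S.schemeToSpec p (h p))) ∧
        -- the schemes are glued from the decompositions of the open structural subspaces
        (∀ p (V : Opens S.space) (hV : (S.restrict V).IsLocallyRinged),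
          Nonempty ((S.restrict V).locallyRingedSpace hV p ≅
            (S.part p).restrict V.isOpenEmbedding)) ∧
        -- their Hochschild complexes exist and form a square/rectangle
        (∀ p, HasInjectiveResolutions
          (pullback (S.schemeToSpec p (h p)) (S.schemeToSpec p (h p))).Modules) ∧
        ∀ (A : ∀ p, (S.scheme p (h p)).Modules)
          (I : ∀ p, InjectiveResolution (diagonalModule (S.schemeToSpec p (h p)) (A p))),
          (∀ p [HasInjectiveResolutions
              (pullback (S.schemeToSpec p (h p)) (S.schemeToSpec p (h p))).Modules] (q : ℕ),
            Nonempty ((schemeHochschild (S.schemeToSpec p (h p)) (I p)).homology q ≅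
              ((homFromDiagonal (S.schemeToSpec p (h p))).rightDerived q).obj
                (diagonalModule (S.schemeToSpec p (h p)) (A p)))) ∧
          (∀ γ, (Rectangle.trivial (S.rows ord h I)).IsAdmissible γ) ∧
          (Rectangle.trivial (S.rows ord h I)).IsDoubleComplex) := by
  refine ⟨fun K _ S => ⟨Rectangle.trivial_isAdmissible _, Rectangle.trivial_isDoubleComplex _, ?_⟩,
    fun K _ _ S hS => ?_⟩
  · refine ⟨relabelFunctor S, relabelHochschildIso S,
      Rectangle.verticalFamilyEquiv (ord.rowIso (relabelHochschildIso S)),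
      relabelFunctor_comp_ι S, relabelHochschildIso_isInducedBy S,
      Rectangle.verticalFamilyEquiv_zero _, Rectangle.comp_verticalFamilyEquiv _,
      Rectangle.sameCohomology_verticalFamilyEquiv _⟩
  · have h : ∀ p, IsScheme (S.part p) := S.toStructuralScheme.isScheme_locallyRingedSpace
    -- Separatedness and finite type are assumed only for those parts that are schemes, so `h` has
    -- to be established first.
    refine ⟨h, fun p => hS p (h p),
      fun p V hV => ⟨S.locallyRingedSpaceRestrictIso S.isLocallyRinged V hV p⟩,
      -- The instance comes from enough injectives in a Grothendieck abelian category.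
      fun p => inferInstance, fun A I => ⟨fun p _ q => ?_, Rectangle.trivial_isAdmissible _,
        Rectangle.trivial_isDoubleComplex _⟩⟩
    exact ⟨((I p).isoRightDerivedObj (homFromDiagonal (S.schemeToSpec p (h p))) q).symm⟩
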